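/- **Theorem.** Let $\mathcal G$ be an undirected graph with finite node set $\mathcal V$ ($|\mathcal V|=n$) and finite edge set $\mathcal E$ ($|\mathcal E|=m$; no self-loops, parallel edges are allowed), and let $B\in\mathbb R^{n\times m}$ be its incidence matrix for an arbitrary labelling of the two ends of each edge by $+$ and $-$ ($B_{ik}=+1$, $-1$ or $0$ if node $i$ is the positive end, the negative end or no end of edge $k$). Let $\mathcal V_e\subseteq\mathcal V$ be the set of actuated nodes, $p=|\mathcal V_e|$, and let $E\in\mathbb R^{n\times p}$ be the 0/1 matrix that places the inputs at the nodes of $\mathcal V_e$ (if $\mathcal V_e=\{1,\dots,p\}$, then $E=\begin{bmatrix}I_{p}\\ \mathbf 0\end{bmatrix}$). Let $T_x,T_\mu,T_\theta,T_\phi$ be diagonal matrices with strictly positive diagonal entries, $d\in\mathbb R^n$, $r\in\mathbb R^p$, $Q=\mathrm{diag}(q_1,\dots,q_p)$ with $q_i>0$, and $\overline y\in\mathbb R^n$. Let $h(x)=(h_i(x_i))_{i\in\mathcal V}$ with $h_i:\mathbb R\to\mathbb R$ continuously differentiable and strictly increasing, $f(\mu)=(f_k(\mu_k))_{k\in\mathcal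 E}$ and $g(\theta)=(g_i(\theta_i))_{i\in\mathcal V_e}$. Let $L^{com}$ be the Laplacian matrix (diagonal matrix of the row sums of the weight matrix, minus the weight matrix) of a directed communication graph on $\mathcal V_e$ with nonnegative weights. Put $$\overline u=Q^{-1}(\kappa-r),\qquad \kappa=E^T\frac{\mathbb 1_n\mathbb 1_n^T}{\mathbb 1_p^TQ^{-1}\mathbb 1_p}\,(d+EQ^{-1}r).$$ Assume: 1. $\mathcal G$ is connected, and $p\ge 1$; 2. $\overline y_i$ is in the range of $h_i$ for every $i\in\mathcal V$; 3. the communication graph is balanced (the weighted in-degree and out-degree of every node agree) and strongly connected; 4. there is $\omega\in\mathbb R^m$ such that $[B^\dagger(E\overline u-d)+(I-B^\dagger B)\omega]_k$ is in the range of $f_k$ for every $k\in\mathcal E$, where $B^\dagger$ is the Moore–Penrose pseudoinverse of $B$, and $\overline u_i$ is in the range of $g_i$ for every $i\in\mathcal V_e$; 5. every $f_k$ and every $g_i$ is continuously differentiable and strictly increasing, with range $(\lambda_k^-,\lambda_k^+)$ and $(u_i^-,u_i^+)$ respectively, where the bounds may be infinite; 6. $\mathcal V_e$ is a zero forcing set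 of $\mathcal G$: if initially exactly the nodes of $\mathcal V_e$ are black and all others white, then all nodes become black by repeated application of the rule "a black node with exactly one white neighbour turns this neighbour black". Consider the closed loop, with flows $\lambda=f(\mu)$ and inputs $u=g(\theta)$, $$\begin{aligned}T_x\dot x&=-Bf(\mu)+Eg(\theta)-d,\\ T_\mu\dot\mu&=B^T(h(x)-\overline y),\\ T_\theta\dot\theta&=-E^T(h(x)-\overline y)-(g(\theta)-\phi),\\ T_\phi\dot\phi&=g(\theta)-\phi-QL^{com}(Q\phi+r).\end{aligned}$$ Then the closed loop has an equilibrium, and for every initial state there is a solution on $[0,\infty)$. Moreover, for every equilibrium $(\overline x,\overline\mu,\overline\theta,\overline\phi)$, every solution on $[0,\infty)$ converges as $t\to\infty$ to a point of the set $$\Upsilon_3=\{(x,\mu,\theta,\phi)\mid B(f(\mu)-f(\overline\mu))=\mathbf 0,\ x=\overline x,\ \theta=\overline\theta,\ \phi=\overline\phi\},$$ and its flow $\lambda=f(\mu)$ converges to the flow at this point. Every point of $\Upsilon_3$ is an equilibrium (so $\lambda=f(\mu)$ is constant there) at which $h(x)=\overline y$ and $u=g(\theta)=\overline u$. Along every solution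 on $[0,\infty)$, $$\lim_{t\to\infty}\|h(x(t))-\overline y\|=0,\qquad \lim_{t\to\infty}\|u(t)-\overline u\|=0,$$ and $\lambda_k^-<\lambda_k(t)<\lambda_k^+$ and $u_i^-<u_i(t)<u_i^+$ hold for all $k\in\mathcal E$, $i\in\mathcal V_e$ and $t\ge 0$. -/

import Mathlib

open scoped Matrix Topology
open Filter

noncomputable section

/-- One step of the graph colouring rule (`S` is the set of black nodes): a black node `i` with
exactly one white neighbour `j` turns `j` black. -/
inductive ForcingStep {V : Type*} (G : SimpleGraph V) : Set V → Set V → Prop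
  | force (S : Set V) (i j : V) (hi : i ∈ S) (hj : j ∉ S) (hij : G.Adj i j)
      (huniq : ∀ k, G.Adj i k → k ∉ S → k = j) : ForcingStep G S (insert j S)

/-- `S` is a zero forcing set: repeated application of the colouring rule, starting from the black
set `S`, turns every node black. -/
def IsZeroForcingSet {V : Type*} (G : SimpleGraph V) (S : Set V) : Prop :=
  Relation.ReflTransGen (ForcingStep G) S Set.univ

/-- `P` is the Moore-Penrose pseudoinverse of the real matrix `A` (the four Penrose conditions,
which determine `P` uniquely). -/
structure IsMoorePenroseInverse {m n : Type*} [Fintype m] [Fintype n]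
    (A : Matrix m n ℝ) (P : Matrix n m ℝ) : Prop where
  mul_mul_self : A * P * A = A
  self_mul_mul : P * A * P = P
  symm_left : (A * P)ᵀ = A * P
  symm_right : (P * A)ᵀ = P * A

/-- The data of a flow network together with the data of its node and edge dynamics.
`V` is the set of nodes and `K` the set of edges. -/
structure FlowNetwork (V K : Type*) [Fintype V] [DecidableEq V] [Fintype K] [DecidableEq K] where
  /-- the end of an edge labelled `+` -/
  pos : K → V
  /-- the end of an edge labelled `-` -/
  neg : K → V
  pos_ne_neg : ∀ k, pos k ≠ neg k
  /-- the set of actuated nodes -/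
  Ve : Finset V
  /-- diagonal entries of `T_x` -/
  Tx : V → ℝ
  Tx_pos : ∀ i, 0 < Tx i
  /-- the constant disturbance -/
  d : V → ℝ
  /-- the output maps `h_i` -/
  h : V → ℝ → ℝ
  h_contDiff : ∀ i, ContDiff ℝ 1 (h i)
  h_strictMono : ∀ i, StrictMono (h i)
  /-- the desired setpoint for the output -/
  ybar : V → ℝ
  /-- coefficients of the quadratic costs `q_i u_i ^ 2 / 2 + r_i u_i + s_i` -/
  q : Ve → ℝ
  q_pos : ∀ i, 0 < q i
  r : Ve → ℝ
  /-- diagonal entries of `T_μ` -/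
  Tμ : K → ℝ
  Tμ_pos : ∀ k, 0 < Tμ k
  /-- the flow maps `f_k` -/
  f : K → ℝ → ℝ
  /-- diagonal entries of `T_θ` -/
  Tθ : Ve → ℝ
  Tθ_pos : ∀ i, 0 < Tθ i
  /-- diagonal entries of `T_φ` -/
  Tφ : Ve → ℝ
  Tφ_pos : ∀ i, 0 < Tφ i
  /-- the input maps `g_i` -/
  g : Ve → ℝ → ℝ
  /-- weights of the directed communication graph; there is an arc `(i, j)` iff `0 < w i j` -/
  w : Ve → Ve → ℝ
  w_nonneg : ∀ i j, 0 ≤ w i j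
  /-- bounds on the flows; infinite bounds mean that there is no constraint -/
  flowLo : K → EReal
  flowHi : K → EReal
  /-- bounds on the inputs; infinite bounds mean that there is no constraint -/
  inputLo : Ve → EReal
  inputHi : Ve → EReal

namespace FlowNetwork

variable {V K : Type*} [Fintype V] [DecidableEq V] [Fintype K] [DecidableEq K]
variable (N : FlowNetwork V K)

/-- The undirected graph of the network: two nodes are adjacent iff they are the ends of an edge. -/
def graph : SimpleGraph V where
  Adj i j := ∃ k, (N.pos k = i ∧ N.neg k = j) ∨ (N.pos k = j ∧ N.neg k = i)
  symm := ⟨fun _ _ ⟨k, hk⟩ => ⟨k, hk.symm⟩⟩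
  loopless := ⟨by
    rintro i ⟨k, ⟨h1, h2⟩ | ⟨h1, h2⟩⟩ <;> exact N.pos_ne_neg k (h1.trans h2.symm)⟩

/-- The incidence matrix `B`. -/
def B : Matrix V K ℝ :=
  Matrix.of fun i k => if i = N.pos k then 1 else if i = N.neg k then -1 else 0

/-- The matrix `E` that places the inputs at the actuated nodes. -/
def E : Matrix V N.Ve ℝ :=
  Matrix.of fun i j => if i = (j : V) then 1 else 0

/-- `Q = diag(q)`. -/
def Q : Matrix N.Ve N.Ve ℝ := Matrix.diagonal N.q

/-- The Laplacian matrix of the weighted directed communication graph. -/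
def Lcom : Matrix N.Ve N.Ve ℝ :=
  Matrix.diagonal (fun i => ∑ j, N.w i j) - Matrix.of N.w

/-- `h(x)`. -/
def output (x : V → ℝ) : V → ℝ := fun i => N.h i (x i)

/-- `λ = f(μ)`. -/
def flow (μ : K → ℝ) : K → ℝ := fun k => N.f k (μ k)

/-- `u = g(θ)`. -/
def input (θ : N.Ve → ℝ) : N.Ve → ℝ := fun i => N.g i (θ i)

/-- The vector `κ = Eᵀ 𝟙 𝟙ᵀ (d + E Q⁻¹ r) / (𝟙ᵀ Q⁻¹ 𝟙)`. -/
def kappa : N.Ve → ℝ :=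
  ((∑ i, (N.d + N.E *ᵥ (N.Q⁻¹ *ᵥ N.r)) i) / (∑ i, (N.Q⁻¹ *ᵥ 1) i)) • (N.Eᵀ *ᵥ 1)

/-- The optimal input `ū = Q⁻¹ (κ - r)`. -/
def ubar : N.Ve → ℝ := N.Q⁻¹ *ᵥ (N.kappa - N.r)

/-- The states `(x, μ, θ, φ)` of the closed loop. -/
abbrev State : Type _ := (V → ℝ) × (K → ℝ) × (N.Ve → ℝ) × (N.Ve → ℝ)

/-- The right-hand side of the closed loop
`T_x x' = -B f(μ) + E g(θ) - d`, `T_μ μ' = Bᵀ (h(x) - ȳ)`,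
`T_θ θ' = -Eᵀ (h(x) - ȳ) - (g(θ) - φ)`, `T_φ φ' = g(θ) - φ - Q Lcom (Q φ + r)`,
solved for the derivatives. -/
def closedLoop : N.State → N.State := fun (x, μ, θ, φ) =>
  ( fun i => (N.Tx i)⁻¹ * (-(N.B *ᵥ N.flow μ) + N.E *ᵥ N.input θ - N.d) i,
    fun k => (N.Tμ k)⁻¹ * (N.Bᵀ *ᵥ (N.output x - N.ybar)) k,
    fun i => (N.Tθ i)⁻¹ * (-(N.Eᵀ *ᵥ (N.output x - N.ybar)) - (N.input θ - φ)) i,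
    fun i => (N.Tφ i)⁻¹ *
      (N.input θ - φ - N.Q *ᵥ (N.Lcom *ᵥ (N.Q *ᵥ φ + N.r))) i )

/-- `z` is a solution of the closed loop on `[0, ∞)` (values at negative times are irrelevant). -/
def IsSolution (z : ℝ → N.State) : Prop :=
  ∀ t, 0 ≤ t → HasDerivWithinAt z (N.closedLoop (z t)) (Set.Ici 0) t

/-- A steady state of the closed loop. -/
def IsEquilibrium (z : N.State) : Prop := N.closedLoop z = 0

/-- The setpoint is feasible: `ȳ_i ∈ R(h_i)`. -/
def FeasibleSetpoint : Prop := ∀ i, N.ybar i ∈ Set.range (N.h i)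

/-- The communication graph is balanced: weighted in-degrees and out-degrees agree. -/
def CommBalanced : Prop := ∀ i, ∑ j, N.w j i = ∑ j, N.w i j

/-- The communication graph is strongly connected. -/
def CommStronglyConnected : Prop :=
  ∀ i j, Relation.ReflTransGen (fun a b => 0 < N.w a b) i j

/-- Attainability of the steady state: for some `ω`, each component of
`B† (E ū - d) + (I - B† B) ω` is in the range of `f_k`, and `ū_i` is in the range of `g_i`. -/
def Attainable : Prop :=
  (∃ Bp : Matrix K V ℝ, IsMoorePenroseInverse N.B Bp ∧ ∃ ω : K → ℝ, ∀ k,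
      (Bp *ᵥ (N.E *ᵥ N.ubar - N.d) + (1 - Bp * N.B : Matrix K K ℝ) *ᵥ ω : K → ℝ) k ∈ Set.range (N.f k)) ∧
  ∀ i, N.ubar i ∈ Set.range (N.g i)

/-- The maps `f_k` and `g_i` are continuously differentiable and strictly increasing, and their
ranges are the open intervals given by the constraints. -/
structure ControllerOutputs : Prop where
  f_contDiff : ∀ k, ContDiff ℝ 1 (N.f k)
  f_strictMono : ∀ k, StrictMono (N.f k)
  f_range : ∀ k, Set.range (N.f k) = {y : ℝ | N.flowLo k < (y : EReal) ∧ (y : EReal) < N.flowHi k}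
  g_contDiff : ∀ i, ContDiff ℝ 1 (N.g i)
  g_strictMono : ∀ i, StrictMono (N.g i)
  g_range : ∀ i,
    Set.range (N.g i) = {y : ℝ | N.inputLo i < (y : EReal) ∧ (y : EReal) < N.inputHi i}

/-- The set `Υ₃` attached to a steady state `(x̄, μ̄, θ̄, φ̄)`. -/
def Upsilon : N.State → Set N.State := fun (xb, μb, θb, φb) =>
  {(x, μ, θ, φ) | N.B *ᵥ (N.flow μ - N.flow μb) = 0 ∧ x = xb ∧ θ = θb ∧ φ = φb}

/-- The objectives and constraints of the design problem along a trajectory `(x, μ, θ, φ)`: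
output regulation, optimal feedforward input, flow capacities and input limitations. -/
structure MeetsObjectives (z : ℝ → N.State) : Prop where
  output_regulation :
    Tendsto (fun t => ‖WithLp.toLp 2 (N.output (z t).1 - N.ybar)‖) atTop (𝓝 0)
  optimal_input :
    Tendsto (fun t => ‖WithLp.toLp 2 (N.input (z t).2.2.1 - N.ubar)‖) atTop (𝓝 0)
  flow_capacity : ∀ t, 0 ≤ t → ∀ k,
    N.flowLo k < (N.flow (z t).2.1 k : EReal) ∧ (N.flow (z t).2.1 k : EReal) < N.flowHi k
  input_limitation : ∀ t, 0 ≤ t → ∀ i,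
    N.inputLo i < (N.input (z t).2.2.1 i : EReal) ∧
      (N.input (z t).2.2.1 i : EReal) < N.inputHi i

end FlowNetwork

end

/-! The closed loop is a passive interconnection. Centred at an equilibrium, the storage function is
the weighted sum of the integrals of `h_i - h_i(x̄_i)`, `f_k - f_k(μ̄_k)`, `g_i - g_i(θ̄_i)` and
`φ_i - φ̄_i`. The terms in `B` and `E` cancel along the flow, and with `ψ = Qφ + r` its derivative
is `-|g(θ) - φ|² - ψᵀ L ψ`; balance makes `ψᵀ L ψ` half the sum of `w_ij (ψ_i - ψ_j)²`
(`storageDeriv_closedLoop`). Strict monotonicity makes the sublevel sets compact even if `f` and `g`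
are bounded, so solutions are global and bounded.

By LaSalle, every solution has a limit point from which a solution without dissipation starts. Along
it `g(θ) = φ` and `L ψ = 0`, so `φ`, hence `θ`, is constant, and the outputs on `V_e` are at their
setpoints. Zero forcing carries this to all nodes (`output_eq_of_forcing`): a regulated node has
constant net flow; if a single neighbour `j` is unregulated, the edges to `j` are driven in the same
signed direction and the other edges are at rest, so increasing flow maps allow no motion. The limit
point is therefore an equilibrium.

Centring the storage at that limit point upgrades subsequential convergence to convergence to a
single point. Finally, `isEquilibrium_iff` identifies the equilibria: `h(x) = ȳ`, `g(θ) = φ = ū`, `B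
f(μ) = E ū - d`, so they form exactly `Υ₃`. -/

noncomputable section

/-! ### Autonomous equations on the half-line -/

/-- `z` is a solution of the autonomous equation `z' = F z` on `[0, ∞)`. -/
def IsForwardSolution {E : Type*} [NormedAddCommGroup E] [NormedSpace ℝ E]
    (F : E → E) (z : ℝ → E) : Prop :=
  ∀ t, 0 ≤ t → HasDerivWithinAt z (F (z t)) (Set.Ici 0) t

namespace IsForwardSolution

variable {E : Type*} [NormedAddCommGroup E] [NormedSpace ℝ E] {F : E → E} {z w : ℝ → E}

theorem continuousOn (hz : IsForwardSolution F z) : ContinuousOn z (Set.Ici 0) :=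
  fun t ht => (hz t ht).continuousWithinAt

theorem congr {G : E → E} (hz : IsForwardSolution F z) (h : ∀ t, 0 ≤ t → F (z t) = G (z t)) :
    IsForwardSolution G z := fun t ht => h t ht ▸ hz t ht

theorem comp_add_const (hz : IsForwardSolution F z) {s : ℝ} (hs : 0 ≤ s) :
    IsForwardSolution F (fun t => z (t + s)) := by
  intro t ht
  have h1 := hz (t + s) (by positivity)
  have h2 : HasDerivWithinAt (fun t : ℝ => t + s) 1 (Set.Ici 0) t :=
    ((hasDerivAt_id t).add_const s).hasDerivWithinAt
  have h3 : Set.MapsTo (fun t : ℝ => t + s) (Set.Ici 0) (Set.Ici 0) := by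
    intro u hu
    simp only [Set.mem_Ici] at hu ⊢
    positivity
  have h4 := h1.scomp t h2 h3
  rwa [one_smul] at h4

/-- Solutions of a Lipschitz equation depend continuously on the initial state. -/
theorem dist_le {K : NNReal} (hF : LipschitzWith K F) (hz : IsForwardSolution F z)
    (hw : IsForwardSolution F w) {t : ℝ} (ht : 0 ≤ t) :
    dist (z t) (w t) ≤ dist (z 0) (w 0) * Real.exp (K * t) := by
  have := dist_le_of_trajectories_ODE (v := fun _ => F) (K := K) (f := z) (g := w)
    (a := 0) (b := t) (δ := dist (z 0) (w 0)) (fun _ => hF)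
    (hz.continuousOn.mono Set.Icc_subset_Ici_self)
    (fun s hs => (hz s hs.1).mono (Set.Ici_subset_Ici.2 hs.1))
    (hw.continuousOn.mono Set.Icc_subset_Ici_self)
    (fun s hs => (hw s hs.1).mono (Set.Ici_subset_Ici.2 hs.1)) le_rfl t ⟨ht, le_rfl⟩
  simpa using this

end IsForwardSolution

theorem eq_of_hasDerivWithinAt_Ici_zero {E : Type*} [NormedAddCommGroup E] [NormedSpace ℝ E]
    {γ : ℝ → E} (h : ∀ t, 0 ≤ t → HasDerivWithinAt γ 0 (Set.Ici 0) t) {t : ℝ} (ht : 0 ≤ t) :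
    γ t = γ 0 := by
  have hc : ContinuousOn γ (Set.Icc 0 t) :=
    fun s hs => (h s hs.1).continuousWithinAt.mono Set.Icc_subset_Ici_self
  exact constant_of_has_deriv_right_zero hc
    (fun s hs => (h s hs.1).mono (Set.Ici_subset_Ici.2 hs.1)) t ⟨ht, le_rfl⟩

theorem HasDerivWithinAt.eq_zero_of_const_Ici {E : Type*} [NormedAddCommGroup E] [NormedSpace ℝ E]
    {γ : ℝ → E} {γ' : E} {t : ℝ} (h : HasDerivWithinAt γ γ' (Set.Ici 0) t) (ht : 0 ≤ t)
    (hγ : ∀ s, 0 ≤ s → γ s = γ 0) : γ' = 0 := by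
  have h0 : HasDerivWithinAt γ 0 (Set.Ici 0) t :=
    (hasDerivWithinAt_const t (Set.Ici 0) (γ 0)).congr (fun s hs => hγ s hs) (hγ t ht)
  exact (uniqueDiffOn_Ici (0 : ℝ) t ht).eq_deriv _ h h0

/-- A bounded Lipschitz vector field has solutions on `[0, ∞)` for all initial states. -/
theorem LipschitzWith.exists_isForwardSolution {E : Type*} [NormedAddCommGroup E] [NormedSpace ℝ E]
    [CompleteSpace E] {F : E → E} {K L : NNReal} (hF : LipschitzWith K F)
    (hL : ∀ x, ‖F x‖ ≤ L) (x₀ : E) : ∃ z, IsForwardSolution F z ∧ z 0 = x₀ := by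
  have hloc : ∀ n : ℕ, ∃ α : ℝ → E, α 0 = x₀ ∧
      ∀ t ∈ Set.Icc (0 : ℝ) n, HasDerivWithinAt α (F (α t)) (Set.Icc 0 n) t := by
    intro n
    -- A field bounded by `L` moves a point by at most `L * n` in time `n`, so the ball of this
    -- radius is never left.
    have hPL : IsPicardLindelof (fun _ => F) (tmin := 0) (tmax := n)
        ⟨0, le_rfl, Nat.cast_nonneg n⟩ x₀ (L * n) 0 L K :=
      IsPicardLindelof.of_time_independent (fun x _ => hL x) hF.lipschitzOnWith (by simp)
    exact hPL.exists_eq_forall_mem_Icc_hasDerivWithinAt₀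
  choose α hα0 hα using hloc
  have huniq : ∀ (m n : ℕ) (s : ℝ), 0 ≤ s → s ≤ m → s ≤ n → α m s = α n s := by
    intro m n s hs hm hn
    have key : ∀ n : ℕ, s ≤ n → ContinuousOn (α n) (Set.Icc 0 s) ∧
        ∀ t ∈ Set.Ico 0 s, HasDerivWithinAt (α n) (F (α n t)) (Set.Ici t) t := by
      intro n hn
      refine ⟨fun t ht => ((hα n t ⟨ht.1, ht.2.trans hn⟩).continuousWithinAt).mono
        (Set.Icc_subset_Icc_right hn), fun t ht => ?_⟩
      refine (hα n t ⟨ht.1, ht.2.le.trans hn⟩).mono_of_mem_nhdsWithin ?_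
      exact mem_of_superset (Icc_mem_nhdsGE (ht.2.trans_le hn)) (Set.Icc_subset_Icc_left ht.1)
    exact ODE_solution_unique_of_mem_Icc_right (v := fun _ => F) (s := fun _ => Set.univ)
      (fun _ _ => hF.lipschitzOnWith) (key m hm).1 (key m hm).2 (fun _ _ => trivial)
      (key n hn).1 (key n hn).2 (fun _ _ => trivial) ((hα0 m).trans (hα0 n).symm) ⟨hs, le_rfl⟩
  -- The `+ 1` puts `t` strictly below the right end of its interval, so `[0, n]` is a neighbourhood
  -- of `t` within `[0, ∞)`.
  refine ⟨fun t => α (⌈t⌉₊ + 1) t, fun t ht => ?_, hα0 _⟩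
  have hceil : ∀ s : ℝ, s < (⌈s⌉₊ + 1 : ℕ) := fun s => by
    push_cast
    exact (Nat.le_ceil s).trans_lt (lt_add_one _)
  set n : ℕ := ⌈t⌉₊ + 1 with hn
  have hmem : Set.Icc (0 : ℝ) n ∈ 𝓝[Set.Ici 0] t := by
    have : Set.Iio (n : ℝ) ∈ 𝓝 t := Iio_mem_nhds (hceil t)
    filter_upwards [self_mem_nhdsWithin, mem_nhdsWithin_of_mem_nhds this] with s hs hs'
    exact ⟨hs, le_of_lt hs'⟩
  refine ((hα n t ⟨ht, (hceil t).le⟩).mono_of_mem_nhdsWithin hmem).congr_of_eventuallyEq ?_ rfl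
  filter_upwards [hmem] with s hs
  exact huniq _ _ s hs.1 (hceil s).le hs.2

/-! ### Lyapunov functions, global existence and LaSalle's principle -/

/-- A continuously differentiable function `W ≥ 0` with compact sublevel sets that does not
increase along the vector field `F`. -/
structure IsLyapunov {E : Type*} [NormedAddCommGroup E] [NormedSpace ℝ E]
    (F : E → E) (W : E → ℝ) (W' : E → E →L[ℝ] ℝ) : Prop where
  hasFDerivAt : ∀ x, HasFDerivAt W (W' x) x
  nonneg : ∀ x, 0 ≤ W x
  isCompact_sublevel : ∀ c, IsCompact {x | W x ≤ c}
  apply_nonpos : ∀ x, W' x (F x) ≤ 0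

namespace IsLyapunov

variable {E : Type*} [NormedAddCommGroup E] [NormedSpace ℝ E] {F : E → E} {W : E → ℝ}
  {W' : E → E →L[ℝ] ℝ}

theorem continuous (hW : IsLyapunov F W W') : Continuous W :=
  continuous_iff_continuousAt.2 fun x => (hW.hasFDerivAt x).continuousAt

theorem smul (hW : IsLyapunov F W W') {χ : E → ℝ} (hχ : ∀ x, 0 ≤ χ x) :
    IsLyapunov (fun x => χ x • F x) W W' where
  hasFDerivAt := hW.hasFDerivAt
  nonneg := hW.nonneg
  isCompact_sublevel := hW.isCompact_sublevel
  apply_nonpos x := by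
    rw [map_smul, smul_eq_mul]
    exact mul_nonpos_of_nonneg_of_nonpos (hχ x) (hW.apply_nonpos x)

theorem hasDerivWithinAt_comp (hW : IsLyapunov F W W') {z : ℝ → E} (hz : IsForwardSolution F z)
    {t : ℝ} (ht : 0 ≤ t) :
    HasDerivWithinAt (fun t => W (z t)) (W' (z t) (F (z t))) (Set.Ici 0) t :=
  (hW.hasFDerivAt (z t)).comp_hasDerivWithinAt t (hz t ht)

theorem antitoneOn (hW : IsLyapunov F W W') {z : ℝ → E} (hz : IsForwardSolution F z) :
    AntitoneOn (fun t => W (z t)) (Set.Ici 0) :=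
  antitoneOn_of_hasDerivWithinAt_nonpos (convex_Ici 0)
    (hW.continuous.comp_continuousOn hz.continuousOn)
    (fun _ ht => (hW.hasDerivWithinAt_comp hz (interior_subset ht)).mono interior_subset)
    (fun _ _ => hW.apply_nonpos _)

theorem le_initial (hW : IsLyapunov F W W') {z : ℝ → E} (hz : IsForwardSolution F z) {t : ℝ}
    (ht : 0 ≤ t) : W (z t) ≤ W (z 0) :=
  hW.antitoneOn hz (Set.mem_Ici.2 le_rfl) ht ht

theorem exists_tendsto (hW : IsLyapunov F W W') {z : ℝ → E} (hz : IsForwardSolution F z) :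
    ∃ l, Tendsto (fun t => W (z t)) atTop (𝓝 l) := by
  -- Clamping time at `0` turns monotonicity on `[0, ∞)` into monotonicity on the whole line.
  have hanti : Antitone fun t : ℝ => W (z (max t 0)) := fun s t hst =>
    hW.antitoneOn hz (Set.mem_Ici.2 (le_max_right s 0)) (Set.mem_Ici.2 (le_max_right t 0))
      (max_le_max_right 0 hst)
  have hbdd : BddBelow (Set.range fun t : ℝ => W (z (max t 0))) :=
    ⟨0, by rintro _ ⟨t, rfl⟩; exact hW.nonneg _⟩
  refine ⟨_, (tendsto_atTop_ciInf hanti hbdd).congr' ?_⟩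
  filter_upwards [eventually_ge_atTop 0] with t ht
  rw [max_eq_left ht]

/-- Multiplication with a cutoff function that is `1` on a sublevel set of a Lyapunov function
turns a continuously differentiable field into a bounded Lipschitz field. -/
theorem exists_cutoff [FiniteDimensional ℝ E] (hW : IsLyapunov F W W') (hF : ContDiff ℝ 1 F)
    (c : ℝ) : ∃ (χ : E → ℝ) (K L : NNReal), (∀ x, 0 ≤ χ x) ∧ (∀ x, W x ≤ c → χ x = 1) ∧
      LipschitzWith K (fun x => χ x • F x) ∧ ∀ x, ‖χ x • F x‖ ≤ L := by
  obtain ⟨R, hR0, hR⟩ := (hW.isCompact_sublevel c).isBounded.subset_closedBall_lt 0 0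
  let χ : ContDiffBump (0 : E) := ⟨R, R + 1, hR0, lt_add_one R⟩
  have hsupp : HasCompactSupport (fun x => χ x • F x) := χ.hasCompactSupport.smul_right
  have hdiff : ContDiff ℝ 1 (fun x => χ x • F x) := χ.contDiff.smul hF
  obtain ⟨K, hK⟩ := hdiff.lipschitzWith_of_hasCompactSupport hsupp one_ne_zero
  obtain ⟨L, hL⟩ := hsupp.exists_bound_of_continuous hdiff.continuous
  exact ⟨χ, K, L.toNNReal, fun x => χ.nonneg, fun _ hx => χ.one_of_mem_closedBall (hR hx), hK,
    fun x => (hL x).trans (Real.le_coe_toNNReal L)⟩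

/-- The cut-off field has a global solution. `W` does not increase along it either, so it stays in
the initial sublevel set, where the cutoff is `1` and the two fields agree. -/
theorem exists_isForwardSolution [FiniteDimensional ℝ E] (hW : IsLyapunov F W W')
    (hF : ContDiff ℝ 1 F) (x₀ : E) : ∃ z, IsForwardSolution F z ∧ z 0 = x₀ := by
  have : CompleteSpace E := FiniteDimensional.complete ℝ E
  obtain ⟨χ, K, L, hχ0, hχ1, hK, hL⟩ := hW.exists_cutoff hF (W x₀)
  obtain ⟨z, hz, hz0⟩ := hK.exists_isForwardSolution hL x₀
  refine ⟨z, hz.congr fun t ht => ?_, hz0⟩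
  have := (hW.smul hχ0).le_initial hz ht
  rw [hz0] at this
  simp [hχ1 _ this]

/-- **LaSalle's invariance principle**: a solution has a limit point from which a solution starts
along which the Lyapunov function is stationary. -/
theorem exists_stationary_solution [FiniteDimensional ℝ E] (hW : IsLyapunov F W W')
    (hF : ContDiff ℝ 1 F) {z : ℝ → E} (hz : IsForwardSolution F z) :
    ∃ w, IsForwardSolution F w ∧ MapClusterPt (w 0) atTop z ∧
      ∀ t, 0 ≤ t → W' (w t) (F (w t)) = 0 := by
  have hfreq : ∃ᶠ t in atTop, z t ∈ {x | W x ≤ W (z 0)} :=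
    ((eventually_ge_atTop (0 : ℝ)).mono fun t ht => hW.le_initial hz ht).frequently
  obtain ⟨p, hp, hcl⟩ := (hW.isCompact_sublevel (W (z 0))).exists_mapClusterPt_of_frequently hfreq
  obtain ⟨w, hw, rfl⟩ := hW.exists_isForwardSolution hF p
  -- Both `z` and `w` stay in this sublevel set, so both solve one globally Lipschitz equation and
  -- continuous dependence on the initial state applies.
  obtain ⟨χ, K, L, hχ0, hχ1, hK, -⟩ := hW.exists_cutoff hF (W (z 0))
  obtain ⟨l, hl⟩ := hW.exists_tendsto hz
  obtain ⟨U, hU, hUz⟩ := mapClusterPt_iff_ultrafilter.1 hcl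
  have hw' : IsForwardSolution (fun x => χ x • F x) w := hw.congr fun t ht => by
    simp [hχ1 _ ((hW.le_initial hw ht).trans hp)]
  have hz' : IsForwardSolution (fun x => χ x • F x) z := hz.congr fun t ht => by
    simp [hχ1 _ (hW.le_initial hz ht)]
  have hconst : ∀ t, 0 ≤ t → W (w t) = l := by
    intro t ht
    -- Along `U` the states `z s` tend to `w 0`, so the time-shifted solutions follow `w`; `W` along
    -- them tends to `l` for every fixed `t`.
    have h1 : Tendsto (fun s => z (t + s)) U (𝓝 (w t)) := by
      rw [tendsto_iff_dist_tendsto_zero] at hUz ⊢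
      have h2 := hUz.mul_const (Real.exp (K * t))
      rw [zero_mul] at h2
      refine squeeze_zero' (.of_forall fun s => dist_nonneg) ?_ h2
      filter_upwards [hU (eventually_ge_atTop (0 : ℝ))] with s hs
      simpa using (hz'.comp_add_const hs).dist_le hK hw' ht
    have h3 : Tendsto (fun s => W (z (t + s))) U (𝓝 l) :=
      (hl.comp (tendsto_atTop_add_const_left atTop t tendsto_id)).mono_left hU
    exact tendsto_nhds_unique ((hW.continuous.tendsto _).comp h1) h3
  refine ⟨w, hw, hcl, fun t ht => ?_⟩
  exact (hW.hasDerivWithinAt_comp hw ht).eq_zero_of_const_Ici ht fun s hs =>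
    (hconst s hs).trans (hconst 0 le_rfl).symm

/-- A solution converges to a limit point at which a Lyapunov function has its only zero. -/
theorem tendsto_of_mapClusterPt (hW : IsLyapunov F W W') {z : ℝ → E}
    (hz : IsForwardSolution F z) {p : E} (hp : ∀ x, W x = 0 ↔ x = p)
    (hcl : MapClusterPt p atTop z) : Tendsto z atTop (𝓝 p) := by
  obtain ⟨l, hl⟩ := hW.exists_tendsto hz
  have hl0 : l = 0 := by
    obtain ⟨U, hU, hUz⟩ := mapClusterPt_iff_ultrafilter.1 hcl
    rw [← (hp p).2 rfl]
    exact tendsto_nhds_unique (hl.mono_left hU) ((hW.continuous.tendsto _).comp hUz)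
  -- By compactness every ultrafilter finer than `atTop` has a limit `q` of `z`; there `W q = l =
  -- 0`, which forces `q = p`.
  rw [tendsto_iff_ultrafilter]
  intro U hU
  have hmem : {x | W x ≤ W (z 0)} ∈ U.map z := by
    have := (eventually_ge_atTop (0 : ℝ)).mono fun t ht => hW.le_initial hz ht
    exact hU this
  obtain ⟨q, -, hq⟩ := (hW.isCompact_sublevel (W (z 0))).ultrafilter_le_nhds' _ hmem
  have hq' : Tendsto z U (𝓝 q) := hq
  have : W q = 0 := by
    rw [← hl0]
    exact tendsto_nhds_unique ((hW.continuous.tendsto _).comp hq') (hl.mono_left hU)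
  rwa [(hp q).1 this] at hq'

end IsLyapunov

/-! ### Potentials of increasing functions -/

/-- The integral of `φ - φ a` from `a`. -/
def potential (φ : ℝ → ℝ) (a x : ℝ) : ℝ := ∫ s in a..x, (φ s - φ a)

section potential

variable {φ : ℝ → ℝ} {a : ℝ}

theorem hasDerivAt_potential (hφ : Continuous φ) (x : ℝ) :
    HasDerivAt (potential φ a) (φ x - φ a) x := by
  have hc : Continuous fun s => φ s - φ a := by fun_prop
  exact intervalIntegral.integral_hasDerivAt_right (hc.intervalIntegrable _ _)
    (hc.stronglyMeasurableAtFilter _ _) hc.continuousAt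

theorem potential_self : potential φ a a = 0 := intervalIntegral.integral_same

/-- The potential of a monotone function is convex: it lies above its tangents. -/
theorem potential_add_mul_le (hφ : Continuous φ) (hm : Monotone φ) (x y : ℝ) :
    potential φ a x + (φ x - φ a) * (y - x) ≤ potential φ a y := by
  have hd : deriv (potential φ a) = fun x => φ x - φ a :=
    funext fun x => (hasDerivAt_potential hφ x).deriv
  have hcv : ConvexOn ℝ Set.univ (potential φ a) := by
    refine Monotone.convexOn_univ_of_deriv
      (fun x => (hasDerivAt_potential hφ x).differentiableAt) ?_
    rw [hd]
    exact fun s t hst => sub_le_sub_right (hm hst) _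
  rcases lt_trichotomy x y with h | rfl | h
  · have := hcv.le_slope_of_hasDerivAt (Set.mem_univ x) (Set.mem_univ y) h
      (hasDerivAt_potential hφ x)
    rw [slope_def_field, le_div_iff₀ (sub_pos.2 h)] at this
    linarith
  · simp
  · have := hcv.slope_le_of_hasDerivAt (Set.mem_univ y) (Set.mem_univ x) h
      (hasDerivAt_potential hφ x)
    rw [slope_def_field, div_le_iff₀ (sub_pos.2 h)] at this
    linarith

theorem potential_nonneg (hφ : Continuous φ) (hm : Monotone φ) (x : ℝ) : 0 ≤ potential φ a x := by
  simpa [potential_self] using potential_add_mul_le (a := a) hφ hm a x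

theorem mul_potential_nonneg {T : ℝ} (hT : 0 < T) (hφ : Continuous φ) (hm : StrictMono φ) (x : ℝ) :
    0 ≤ T * potential φ a x :=
  mul_nonneg hT.le (potential_nonneg hφ hm.monotone x)

theorem potential_eq_zero_iff (hφ : Continuous φ) (hm : StrictMono φ) (x : ℝ) :
    potential φ a x = 0 ↔ x = a := by
  refine ⟨fun h => ?_, fun h => h ▸ potential_self⟩
  by_contra hne
  -- The tangent at the midpoint has nonzero slope and rises towards `x`, so the potential at `x`
  -- would be positive.
  have h1 := potential_add_mul_le (a := a) hφ hm.monotone ((x + a) / 2) x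
  have h2 := potential_nonneg (a := a) hφ hm.monotone ((x + a) / 2)
  rcases lt_or_gt_of_ne hne with hlt | hlt
  · nlinarith [hm (show (x + a) / 2 < a by linarith)]
  · nlinarith [hm (show a < (x + a) / 2 by linarith)]

/-- The tangents at `a - 1` and `a + 1` have slopes of opposite sign, so the potential grows at
least linearly on both sides, even if `φ` is bounded. The bounds are where these tangents, with
their nonnegative values at the points of contact dropped, reach `c`. -/
theorem exists_forall_potential_le (hφ : Continuous φ) (hm : StrictMono φ) (c : ℝ) :
    ∃ lo hi, ∀ x, potential φ a x ≤ c → x ∈ Set.Icc lo hi := by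
  have hp := sub_pos.2 (hm (show a < a + 1 by linarith))
  have hn := sub_pos.2 (hm (show a - 1 < a by linarith))
  refine ⟨a - 1 - c / (φ a - φ (a - 1)), a + 1 + c / (φ (a + 1) - φ a), fun x hx => ⟨?_, ?_⟩⟩
  · have h1 := potential_add_mul_le (a := a) hφ hm.monotone (a - 1) x
    have h2 := potential_nonneg (a := a) hφ hm.monotone (a - 1)
    have h3 : a - 1 - x ≤ c / (φ a - φ (a - 1)) := by
      rw [le_div_iff₀ hn]
      nlinarith
    linarith
  · have h1 := potential_add_mul_le (a := a) hφ hm.monotone (a + 1) x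
    have h2 := potential_nonneg (a := a) hφ hm.monotone (a + 1)
    have h3 : x - (a + 1) ≤ c / (φ (a + 1) - φ a) := by
      rw [le_div_iff₀ hp]
      nlinarith
    linarith

end potential

/-- The weighted sum of the potentials of the components. -/
def sumPotential {ι : Type*} [Fintype ι] (T : ι → ℝ) (φ : ι → ℝ → ℝ) (a x : ι → ℝ) : ℝ :=
  ∑ i, T i * potential (φ i) (a i) (x i)

/-- The derivative of `sumPotential`. -/
def sumPotentialDeriv {ι : Type*} [Fintype ι] (T : ι → ℝ) (φ : ι → ℝ → ℝ) (a x : ι → ℝ) :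
    (ι → ℝ) →L[ℝ] ℝ :=
  ∑ i, (T i * (φ i (x i) - φ i (a i))) • ContinuousLinearMap.proj i

section sumPotential

variable {ι : Type*} [Fintype ι] {T : ι → ℝ} {φ : ι → ℝ → ℝ} {a : ι → ℝ}

theorem hasFDerivAt_sumPotential (hφ : ∀ i, Continuous (φ i)) (x : ι → ℝ) :
    HasFDerivAt (sumPotential T φ a) (sumPotentialDeriv T φ a x) x := by
  refine HasFDerivAt.fun_sum fun i _ => ?_
  have h0 : HasFDerivAt (fun y : ι → ℝ => y i)
      (ContinuousLinearMap.proj (R := ℝ) (φ := fun _ : ι => ℝ) i) x :=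
    (ContinuousLinearMap.proj (R := ℝ) (φ := fun _ : ι => ℝ) i).hasFDerivAt
  have h1 := ((hasDerivAt_potential (a := a i) (hφ i) (x i)).comp_hasFDerivAt x h0).const_mul (T i)
  rwa [smul_smul] at h1

/-- The weights of the potential cancel the inverse time constants of the closed loop. -/
theorem sumPotentialDeriv_apply_inv_mul (hT : ∀ i, 0 < T i) (x v : ι → ℝ) :
    sumPotentialDeriv T φ a x (fun i => (T i)⁻¹ * v i) =
      ∑ i, (φ i (x i) - φ i (a i)) * v i := by
  simp only [sumPotentialDeriv, FunLike.coe_sum, Finset.sum_apply,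
    smul_apply, ContinuousLinearMap.proj_apply, smul_eq_mul]
  refine Finset.sum_congr rfl fun i _ => ?_
  have := (hT i).ne'
  field_simp

theorem sumPotential_nonneg (hT : ∀ i, 0 < T i) (hφ : ∀ i, Continuous (φ i))
    (hm : ∀ i, StrictMono (φ i)) (x : ι → ℝ) : 0 ≤ sumPotential T φ a x :=
  Finset.sum_nonneg fun i _ => mul_potential_nonneg (hT i) (hφ i) (hm i) (x i)

theorem sumPotential_eq_zero_iff (hT : ∀ i, 0 < T i) (hφ : ∀ i, Continuous (φ i))
    (hm : ∀ i, StrictMono (φ i)) (x : ι → ℝ) : sumPotential T φ a x = 0 ↔ x = a := by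
  rw [sumPotential,
    Finset.sum_eq_zero_iff_of_nonneg fun i _ => mul_potential_nonneg (hT i) (hφ i) (hm i) (x i),
    funext_iff]
  simp [(hT _).ne', potential_eq_zero_iff (hφ _) (hm _)]

theorem exists_forall_sumPotential_le (hT : ∀ i, 0 < T i) (hφ : ∀ i, Continuous (φ i))
    (hm : ∀ i, StrictMono (φ i)) (c : ℝ) :
    ∃ lo hi, ∀ x, sumPotential T φ a x ≤ c → x ∈ Set.Icc lo hi := by
  choose lo hi h using fun i => exists_forall_potential_le (a := a i) (hφ i) (hm i) (c / T i)
  have key : ∀ x, sumPotential T φ a x ≤ c → ∀ i, x i ∈ Set.Icc (lo i) (hi i) := by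
    intro x hx i
    refine h i _ ?_
    rw [le_div_iff₀ (hT i), mul_comm]
    exact (Finset.single_le_sum (f := fun i => T i * potential (φ i) (a i) (x i))
      (fun i _ => mul_potential_nonneg (hT i) (hφ i) (hm i) (x i)) (Finset.mem_univ i)).trans hx
  exact ⟨lo, hi, fun x hx => ⟨fun i => (key x hx i).1, fun i => (key x hx i).2⟩⟩

end sumPotential

/-! ### Network matrices, optimal inputs and equilibria -/

theorem IsMoorePenroseInverse.transpose_mulVec_residual {m n : Type*} [Fintype m] [Fintype n]
    {A : Matrix m n ℝ} {P : Matrix n m ℝ} (h : IsMoorePenroseInverse A P) (v : m → ℝ) :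
    Aᵀ *ᵥ (v - A *ᵥ (P *ᵥ v)) = 0 := by
  -- `A * P` is the orthogonal projection onto the column space of `A`, so the residual is
  -- orthogonal to it.
  have h1 : Aᵀ * (A * P) = Aᵀ := by
    rw [← h.symm_left, ← Matrix.transpose_mul, h.mul_mul_self]
  rw [Matrix.mulVec_sub, Matrix.mulVec_mulVec, Matrix.mulVec_mulVec, Matrix.mul_assoc, h1,
    sub_self]

namespace FlowNetwork

variable {V K : Type*} [Fintype V] [DecidableEq V] [Fintype K] [DecidableEq K]
variable (N : FlowNetwork V K)

theorem B_transpose_mulVec (v : V → ℝ) (k : K) :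
    (N.Bᵀ *ᵥ v) k = v (N.pos k) - v (N.neg k) := by
  have h : ∀ i, N.B i k * v i =
      (if i = N.pos k then v i else 0) - (if i = N.neg k then v i else 0) := by
    intro i
    have := N.pos_ne_neg k
    simp only [B, Matrix.of_apply]
    split_ifs with h1 h2 <;> first | (exact absurd (h1.symm.trans h2) this) | simp
  simp only [Matrix.mulVec, dotProduct, Matrix.transpose_apply, h, Finset.sum_sub_distrib,
    Finset.sum_ite_eq', Finset.mem_univ, if_true]

theorem E_transpose_mulVec (v : V → ℝ) (i : N.Ve) : (N.Eᵀ *ᵥ v) i = v i := by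
  simp [E, Matrix.mulVec, dotProduct]

theorem dotProduct_B_mulVec (v : V → ℝ) (l : K → ℝ) :
    v ⬝ᵥ (N.B *ᵥ l) = (N.Bᵀ *ᵥ v) ⬝ᵥ l := by
  rw [Matrix.dotProduct_mulVec, Matrix.mulVec_transpose]

theorem dotProduct_E_mulVec (v : V → ℝ) (u : N.Ve → ℝ) :
    v ⬝ᵥ (N.E *ᵥ u) = (N.Eᵀ *ᵥ v) ⬝ᵥ u := by
  rw [Matrix.dotProduct_mulVec, Matrix.mulVec_transpose]

theorem sum_B_mulVec (l : K → ℝ) : ∑ i, (N.B *ᵥ l) i = 0 := by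
  rw [← one_dotProduct, dotProduct_B_mulVec]
  have : N.Bᵀ *ᵥ (1 : V → ℝ) = 0 := funext fun k => by simp [B_transpose_mulVec]
  rw [this, zero_dotProduct]

theorem sum_E_mulVec (u : N.Ve → ℝ) : ∑ i, (N.E *ᵥ u) i = ∑ i, u i := by
  rw [← one_dotProduct, dotProduct_E_mulVec, ← one_dotProduct]
  congr 1
  exact funext fun i => by simp [E_transpose_mulVec]

theorem Q_mulVec (u : N.Ve → ℝ) (i : N.Ve) : (N.Q *ᵥ u) i = N.q i * u i := by
  simp [Q, Matrix.mulVec_diagonal]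

theorem Q_inv_mulVec (u : N.Ve → ℝ) (i : N.Ve) : (N.Q⁻¹ *ᵥ u) i = u i / N.q i := by
  have h : N.Q⁻¹ = Matrix.diagonal fun i => (N.q i)⁻¹ := by
    refine Matrix.inv_eq_left_inv ?_
    rw [Q, Matrix.diagonal_mul_diagonal, ← Matrix.diagonal_one]
    congr 1
    exact funext fun i => inv_mul_cancel₀ (N.q_pos i).ne'
  rw [h, Matrix.mulVec_diagonal, div_eq_inv_mul]

/-- The common marginal cost of the optimal input. -/
def marginalCost : ℝ :=
  (∑ i, (N.d + N.E *ᵥ (N.Q⁻¹ *ᵥ N.r)) i) / (∑ i, (N.Q⁻¹ *ᵥ 1) i)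

theorem kappa_apply (i : N.Ve) : N.kappa i = N.marginalCost := by
  simp [kappa, marginalCost, E_transpose_mulVec]

theorem ubar_apply (i : N.Ve) : N.ubar i = (N.marginalCost - N.r i) / N.q i := by
  rw [ubar, Q_inv_mulVec, Pi.sub_apply, kappa_apply]

theorem sum_inv_q_pos (hact : N.Ve.Nonempty) : 0 < ∑ i, 1 / N.q i := by
  have : Nonempty N.Ve := hact.to_subtype
  exact Finset.sum_pos (fun i _ => one_div_pos.2 (N.q_pos i)) Finset.univ_nonempty

/-- This normalisation makes the inputs `(c - r_i) / q_i` add up to the total demand precisely for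
`c = marginalCost`. -/
theorem marginalCost_mul (hact : N.Ve.Nonempty) :
    N.marginalCost * ∑ i, 1 / N.q i = ∑ i, N.d i + ∑ i, N.r i / N.q i := by
  have h := (N.sum_inv_q_pos hact).ne'
  simp only [marginalCost, Pi.add_apply, Finset.sum_add_distrib, sum_E_mulVec, Q_inv_mulVec,
    Pi.one_apply]
  exact div_mul_cancel₀ _ h

theorem sum_cost_div (c : ℝ) :
    ∑ i, (c - N.r i) / N.q i = c * ∑ i, 1 / N.q i - ∑ i, N.r i / N.q i := by
  rw [Finset.mul_sum, ← Finset.sum_sub_distrib]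
  exact Finset.sum_congr rfl fun i _ => by ring

theorem sum_ubar (hact : N.Ve.Nonempty) : ∑ i, N.ubar i = ∑ i, N.d i := by
  simp only [ubar_apply, sum_cost_div, N.marginalCost_mul hact]
  ring

theorem eq_of_B_transpose_mulVec_eq_zero (hconn : N.graph.Connected) {v : V → ℝ}
    (hv : N.Bᵀ *ᵥ v = 0) (i j : V) : v i = v j := by
  obtain ⟨p⟩ := hconn.preconnected i j
  induction p with
  | nil => rfl
  | cons h _ ih =>
    rw [← ih]
    obtain ⟨k, ⟨rfl, rfl⟩ | ⟨rfl, rfl⟩⟩ := h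
    · exact sub_eq_zero.1 ((N.B_transpose_mulVec v k).symm.trans (congrFun hv k))
    · exact (sub_eq_zero.1 ((N.B_transpose_mulVec v k).symm.trans (congrFun hv k))).symm

theorem Lcom_mulVec (ψ : N.Ve → ℝ) (i : N.Ve) :
    (N.Lcom *ᵥ ψ) i = ∑ j, N.w i j * (ψ i - ψ j) := by
  rw [Lcom, Matrix.sub_mulVec, Pi.sub_apply, Matrix.mulVec_diagonal]
  simp only [Matrix.mulVec, dotProduct, Matrix.of_apply, mul_sub, Finset.sum_sub_distrib,
    Finset.sum_mul]

theorem Lcom_mulVec_const {ψ : N.Ve → ℝ} {c : ℝ} (h : ∀ i, ψ i = c) : N.Lcom *ᵥ ψ = 0 :=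
  funext fun i => by simp [Lcom_mulVec, h]

variable {N}

/-- Exchanging the sums replaces out-degrees by in-degrees; this is how balance enters. -/
theorem sum_w_balanced (hbal : N.CommBalanced) (a : N.Ve → ℝ) :
    ∑ i, ∑ j, N.w i j * a j = ∑ i, ∑ j, N.w i j * a i := by
  rw [Finset.sum_comm]
  simp only [← Finset.sum_mul]
  exact Finset.sum_congr rfl fun i _ => by rw [hbal i]

theorem sum_Lcom_mulVec (hbal : N.CommBalanced) (ψ : N.Ve → ℝ) : ∑ i, (N.Lcom *ᵥ ψ) i = 0 := by
  simp only [Lcom_mulVec, mul_sub, Finset.sum_sub_distrib, sum_w_balanced hbal, sub_self]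

/-- After expanding the squares, balance identifies the sums of `w_ij ψ_i²` and `w_ij ψ_j²`; no
symmetry of the weights is needed. -/
theorem dotProduct_Lcom_mulVec (hbal : N.CommBalanced) (ψ : N.Ve → ℝ) :
    ψ ⬝ᵥ (N.Lcom *ᵥ ψ) = (∑ i, ∑ j, N.w i j * (ψ i - ψ j) ^ 2) / 2 := by
  have h := sum_w_balanced hbal fun i => ψ i ^ 2
  have h1 : ∑ i, ∑ j, N.w i j * (ψ i - ψ j) ^ 2 = ∑ i, ∑ j, N.w i j * ψ i ^ 2
      + ∑ i, ∑ j, N.w i j * ψ j ^ 2 - 2 * ∑ i, ∑ j, N.w i j * (ψ i * ψ j) := by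
    simp only [Finset.mul_sum, ← Finset.sum_add_distrib, ← Finset.sum_sub_distrib]
    exact Finset.sum_congr rfl fun i _ => Finset.sum_congr rfl fun j _ => by ring
  have h2 : ψ ⬝ᵥ (N.Lcom *ᵥ ψ) = ∑ i, ∑ j, N.w i j * ψ i ^ 2
      - ∑ i, ∑ j, N.w i j * (ψ i * ψ j) := by
    simp only [dotProduct, Lcom_mulVec, Finset.mul_sum, ← Finset.sum_sub_distrib]
    exact Finset.sum_congr rfl fun i _ => Finset.sum_congr rfl fun j _ => by ring
  rw [h2, h1, h]
  ring

theorem dotProduct_Lcom_mulVec_nonneg (hbal : N.CommBalanced) (ψ : N.Ve → ℝ) :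
    0 ≤ ψ ⬝ᵥ (N.Lcom *ᵥ ψ) := by
  rw [dotProduct_Lcom_mulVec hbal]
  exact div_nonneg (Finset.sum_nonneg fun i _ => Finset.sum_nonneg fun j _ =>
    mul_nonneg (N.w_nonneg i j) (sq_nonneg _)) zero_le_two

theorem eq_of_dotProduct_Lcom_mulVec_eq_zero (hbal : N.CommBalanced)
    (hsc : N.CommStronglyConnected) {ψ : N.Ve → ℝ} (h : ψ ⬝ᵥ (N.Lcom *ᵥ ψ) = 0) (i j : N.Ve) :
    ψ i = ψ j := by
  have hnn : ∀ i j, 0 ≤ N.w i j * (ψ i - ψ j) ^ 2 :=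
    fun i j => mul_nonneg (N.w_nonneg i j) (sq_nonneg _)
  rw [dotProduct_Lcom_mulVec hbal, div_eq_zero_iff, or_iff_left two_ne_zero,
    Finset.sum_eq_zero_iff_of_nonneg fun i _ => Finset.sum_nonneg fun j _ => hnn i j] at h
  have harc : ∀ i j, 0 < N.w i j → ψ i = ψ j := by
    intro i j hij
    have h1 := (Finset.sum_eq_zero_iff_of_nonneg fun j _ => hnn i j).1 (h i (Finset.mem_univ i)) j
      (Finset.mem_univ j)
    exact sub_eq_zero.1 (pow_eq_zero_iff two_ne_zero |>.1
      ((mul_eq_zero.1 h1).resolve_left hij.ne'))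
  have := hsc i j
  induction this with
  | refl => rfl
  | tail _ hbc ih => exact ih.trans (harc _ _ hbc)

theorem isEquilibrium_iff_balance (x : V → ℝ) (μ : K → ℝ) (θ φ : N.Ve → ℝ) :
    N.IsEquilibrium (x, μ, θ, φ) ↔
      -(N.B *ᵥ N.flow μ) + N.E *ᵥ N.input θ - N.d = 0 ∧
      N.Bᵀ *ᵥ (N.output x - N.ybar) = 0 ∧
      -(N.Eᵀ *ᵥ (N.output x - N.ybar)) - (N.input θ - φ) = 0 ∧
      N.input θ - φ - N.Q *ᵥ (N.Lcom *ᵥ (N.Q *ᵥ φ + N.r)) = 0 := by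
  have key : ∀ {ι : Type _} (T v : ι → ℝ), (∀ i, 0 < T i) →
      ((fun i => (T i)⁻¹ * v i) = 0 ↔ v = 0) := by
    intro ι T v hT
    simp [funext_iff, (hT _).ne']
  rw [IsEquilibrium, closedLoop, Prod.mk_eq_zero, Prod.mk_eq_zero, Prod.mk_eq_zero,
    key _ _ N.Tx_pos, key _ _ N.Tθ_pos, key _ _ N.Tφ_pos]
  simp [funext_iff, (N.Tμ_pos _).ne']

/-- If the inputs balance the demand and have a common marginal cost, then they are optimal. -/
theorem eq_ubar_of_marginalCost (hact : N.Ve.Nonempty) {l : K → ℝ} {u : N.Ve → ℝ} {c : ℝ}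
    (hbalance : -(N.B *ᵥ l) + N.E *ᵥ u - N.d = 0) (hc : ∀ i, N.q i * u i + N.r i = c) :
    u = N.ubar := by
  have hu : ∀ i, u i = (c - N.r i) / N.q i := fun i => by
    rw [eq_div_iff (N.q_pos i).ne']
    linarith [hc i]
  have hsum : ∑ i, u i = ∑ i, N.d i := by
    have := congrArg (fun v : V → ℝ => ∑ i, v i) hbalance
    simp only [Pi.add_apply, Pi.sub_apply, Pi.neg_apply, Finset.sum_sub_distrib,
      Finset.sum_add_distrib, Finset.sum_neg_distrib, sum_B_mulVec, sum_E_mulVec, Pi.zero_apply,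
      Finset.sum_const_zero] at this
    linarith
  have hcm : c = N.marginalCost := by
    have h1 := N.marginalCost_mul hact
    simp only [hu, sum_cost_div] at hsum
    exact mul_right_cancel₀ (N.sum_inv_q_pos hact).ne' (by linarith)
  exact funext fun i => by rw [hu, ubar_apply, hcm]

/-- Connectedness makes the output error a constant `e`. The two controller equations then give `(L
ψ)_i = -e / q_i`; since `L ψ` sums to zero by balance, `e = 0`. What remains is `L ψ = 0`, a common
marginal cost by strong connectivity, and balanced inputs with a common marginal cost are `ū`. -/
theorem isEquilibrium_iff (hconn : N.graph.Connected) (hact : N.Ve.Nonempty)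
    (hbal : N.CommBalanced) (hsc : N.CommStronglyConnected)
    (x : V → ℝ) (μ : K → ℝ) (θ φ : N.Ve → ℝ) :
    N.IsEquilibrium (x, μ, θ, φ) ↔ N.output x = N.ybar ∧
      N.B *ᵥ N.flow μ = N.E *ᵥ N.ubar - N.d ∧ N.input θ = N.ubar ∧ φ = N.ubar := by
  rw [isEquilibrium_iff_balance]
  constructor
  · rintro ⟨h1, h2, h3, h4⟩
    obtain ⟨i₀, hi₀⟩ := hact
    set e := N.output x - N.ybar with he
    have hconst : ∀ i, e i = e i₀ := fun i =>
      N.eq_of_B_transpose_mulVec_eq_zero hconn h2 i i₀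
    have hsum := sum_Lcom_mulVec hbal (N.Q *ᵥ φ + N.r)
    have hL : ∀ i, (N.Lcom *ᵥ (N.Q *ᵥ φ + N.r)) i = -e i₀ * (1 / N.q i) := by
      intro i
      have h3' := congrFun h3 i
      have h4' := congrFun h4 i
      simp only [Pi.sub_apply, Pi.neg_apply, Pi.zero_apply, E_transpose_mulVec, hconst,
        Q_mulVec] at h3' h4'
      have := (N.q_pos i).ne'
      field_simp
      linarith
    simp only [hL, ← Finset.mul_sum] at hsum
    have he0 : e i₀ = 0 := neg_eq_zero.1
      ((mul_eq_zero.1 hsum).resolve_right (N.sum_inv_q_pos ⟨i₀, hi₀⟩).ne')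
    have hezero : e = 0 := funext fun i => (hconst i).trans he0
    have hφ : N.input θ = φ := by
      rw [hezero, Matrix.mulVec_zero, neg_zero, zero_sub, neg_eq_zero] at h3
      exact sub_eq_zero.1 h3
    have hψ := eq_of_dotProduct_Lcom_mulVec_eq_zero hbal hsc (ψ := N.Q *ᵥ φ + N.r) (by
      have : N.Lcom *ᵥ (N.Q *ᵥ φ + N.r) = 0 := funext fun i => by simp [hL, he0]
      rw [this, dotProduct_zero])
    have hu : N.input θ = N.ubar := by
      refine eq_ubar_of_marginalCost ⟨i₀, hi₀⟩ h1 (c := (N.Q *ᵥ φ + N.r) ⟨i₀, hi₀⟩) fun i => ?_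
      rw [hφ, ← hψ i, Pi.add_apply, Q_mulVec]
    refine ⟨sub_eq_zero.1 hezero, ?_, hu, hφ ▸ hu⟩
    rw [hu] at h1
    refine (sub_eq_zero.1 ?_).symm
    rw [← h1]
    abel
  · rintro ⟨h1, h2, h3, rfl⟩
    have hL : N.Lcom *ᵥ (N.Q *ᵥ N.ubar + N.r) = 0 := by
      refine N.Lcom_mulVec_const (c := N.marginalCost) fun i => ?_
      rw [Pi.add_apply, Q_mulVec, ubar_apply, mul_div_cancel₀ _ (N.q_pos i).ne']
      ring
    rw [h1, h2, h3, hL]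
    simp

/-- The residual of `E ū - d` after projection onto the range of `B` lies in the kernel of `Bᵀ`, so
it is constant; it sums to zero because `ū` meets the total demand. Hence it vanishes and the flow
given by attainability balances every node. -/
theorem exists_isEquilibrium (hconn : N.graph.Connected) (hact : N.Ve.Nonempty)
    (hset : N.FeasibleSetpoint) (hbal : N.CommBalanced) (hsc : N.CommStronglyConnected)
    (hatt : N.Attainable) : ∃ z, N.IsEquilibrium z := by
  obtain ⟨⟨P, hP, ω, hω⟩, hu⟩ := hatt
  choose x hx using hset
  choose μ hμ using hω
  choose θ hθ using hu
  refine ⟨(x, μ, θ, N.ubar), (isEquilibrium_iff hconn hact hbal hsc _ _ _ _).2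
    ⟨funext hx, ?_, funext hθ, rfl⟩⟩
  set v := N.E *ᵥ N.ubar - N.d with hv
  have hflow : N.flow μ = P *ᵥ v + (1 - P * N.B : Matrix K K ℝ) *ᵥ ω := funext hμ
  have hBω : N.B *ᵥ ((1 - P * N.B : Matrix K K ℝ) *ᵥ ω) = 0 := by
    rw [Matrix.mulVec_mulVec, Matrix.mul_sub, Matrix.mul_one, ← Matrix.mul_assoc,
      hP.mul_mul_self, sub_self, Matrix.zero_mulVec]
  rw [hflow, Matrix.mulVec_add, hBω, add_zero]
  have hconst := N.eq_of_B_transpose_mulVec_eq_zero hconn (hP.transpose_mulVec_residual v)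
  set e := v - N.B *ᵥ (P *ᵥ v) with he
  have hsum : ∑ i, e i = 0 := by
    simp only [he, hv, Pi.sub_apply, Finset.sum_sub_distrib, sum_B_mulVec, sum_E_mulVec,
      N.sum_ubar hact]
    ring
  obtain ⟨i₀, -⟩ := hact
  have hezero : e = 0 := by
    funext i
    simp only [hconst _ i, Finset.sum_const, nsmul_eq_mul] at hsum
    refine (mul_eq_zero.1 hsum).resolve_left ?_
    exact Nat.cast_ne_zero.2 (Finset.card_ne_zero.2 ⟨i₀, Finset.mem_univ i₀⟩)
  exact (sub_eq_zero.1 hezero).symm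

theorem isEquilibrium_of_mem_upsilon (hconn : N.graph.Connected) (hact : N.Ve.Nonempty)
    (hbal : N.CommBalanced) (hsc : N.CommStronglyConnected) {z p : N.State}
    (hz : N.IsEquilibrium z) (hp : p ∈ N.Upsilon z) :
    N.IsEquilibrium p ∧ N.output p.1 = N.ybar ∧ N.input p.2.2.1 = N.ubar := by
  obtain ⟨x, μ, θ, φ⟩ := z
  obtain ⟨x', μ', θ', φ'⟩ := p
  obtain ⟨hB, rfl, rfl, rfl⟩ := hp
  rw [isEquilibrium_iff hconn hact hbal hsc] at hz ⊢
  rw [Matrix.mulVec_sub, sub_eq_zero] at hB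
  exact ⟨⟨hz.1, hB.trans hz.2.1, hz.2.2⟩, hz.1, hz.2.2.1⟩

/-- Injectivity of `h_i` and `g_i` determines `x` and `θ`; the equilibrium conditions fix the flows
only up to the kernel of `B`. -/
theorem mem_upsilon_of_isEquilibrium (hconn : N.graph.Connected) (hact : N.Ve.Nonempty)
    (hbal : N.CommBalanced) (hsc : N.CommStronglyConnected) (hout : N.ControllerOutputs)
    {z p : N.State} (hz : N.IsEquilibrium z) (hp : N.IsEquilibrium p) : p ∈ N.Upsilon z := by
  obtain ⟨x, μ, θ, φ⟩ := z
  obtain ⟨x', μ', θ', φ'⟩ := p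
  rw [isEquilibrium_iff hconn hact hbal hsc] at hz hp
  refine ⟨?_, funext fun i => (N.h_strictMono i).injective ?_,
    funext fun i => (hout.g_strictMono i).injective ?_, hp.2.2.2.trans hz.2.2.2.symm⟩
  · rw [Matrix.mulVec_sub, sub_eq_zero, hp.2.1, hz.2.1]
  · exact congrFun (hp.1.trans hz.1.symm) i
  · exact congrFun (hp.2.2.1.trans hz.2.2.1.symm) i

end FlowNetwork

/-! ### The storage function -/

namespace FlowNetwork

variable {V K : Type*} [Fintype V] [DecidableEq V] [Fintype K] [DecidableEq K]
variable (N : FlowNetwork V K)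

/-- The incremental storage function of the closed loop with respect to the state `zb`. -/
def storage : N.State → N.State → ℝ := fun (xb, μb, θb, φb) (x, μ, θ, φ) =>
  sumPotential N.Tx N.h xb x + sumPotential N.Tμ N.f μb μ +
    sumPotential N.Tθ N.g θb θ + sumPotential N.Tφ (fun _ s => s) φb φ

/-- The derivative of `storage`. -/
def storageDeriv (zb z : N.State) : N.State →L[ℝ] ℝ :=
  (sumPotentialDeriv N.Tx N.h zb.1 z.1).comp (.fst ℝ _ _) +
    (sumPotentialDeriv N.Tμ N.f zb.2.1 z.2.1).comp ((ContinuousLinearMap.fst ℝ _ _).comp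
      (.snd ℝ _ _)) +
    (sumPotentialDeriv N.Tθ N.g zb.2.2.1 z.2.2.1).comp ((ContinuousLinearMap.fst ℝ _ _).comp
      ((ContinuousLinearMap.snd ℝ _ _).comp (.snd ℝ _ _))) +
    (sumPotentialDeriv N.Tφ (fun _ s => s) zb.2.2.2 z.2.2.2).comp
      ((ContinuousLinearMap.snd ℝ _ _).comp
      ((ContinuousLinearMap.snd ℝ _ _).comp (.snd ℝ _ _)))

variable {N}

theorem hasFDerivAt_storage (hout : N.ControllerOutputs) (zb z : N.State) :
    HasFDerivAt (N.storage zb) (N.storageDeriv zb z) z := by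
  have hh := fun i => (N.h_contDiff i).continuous
  have hf := fun k => (hout.f_contDiff k).continuous
  have hg := fun i => (hout.g_contDiff i).continuous
  have hs : HasFDerivAt (fun z : N.State => z.2) (.snd ℝ _ _) z := hasFDerivAt_snd
  have hss := hs.snd
  have h1 := (hasFDerivAt_sumPotential (T := N.Tx) (a := zb.1) hh z.1).comp z hasFDerivAt_fst
  have h2 := (hasFDerivAt_sumPotential (T := N.Tμ) (a := zb.2.1) hf z.2.1).comp z
    hs.fst
  have h3 := (hasFDerivAt_sumPotential (T := N.Tθ) (a := zb.2.2.1) hg z.2.2.1).comp z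
    hss.fst
  have h4 := (hasFDerivAt_sumPotential (T := N.Tφ) (a := zb.2.2.2) (fun _ => continuous_id)
    z.2.2.2).comp z hss.snd
  exact ((h1.add h2).add h3).add h4

theorem storage_nonneg (hout : N.ControllerOutputs) (zb z : N.State) : 0 ≤ N.storage zb z :=
  add_nonneg (add_nonneg (add_nonneg
    (sumPotential_nonneg N.Tx_pos (fun i => (N.h_contDiff i).continuous) N.h_strictMono _)
    (sumPotential_nonneg N.Tμ_pos (fun k => (hout.f_contDiff k).continuous) hout.f_strictMono _))
    (sumPotential_nonneg N.Tθ_pos (fun i => (hout.g_contDiff i).continuous) hout.g_strictMono _))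
    (sumPotential_nonneg N.Tφ_pos (fun _ => continuous_id) (fun _ => strictMono_id) _)

theorem storage_components_le (hout : N.ControllerOutputs) (zb z : N.State) :
    sumPotential N.Tx N.h zb.1 z.1 ≤ N.storage zb z ∧
    sumPotential N.Tμ N.f zb.2.1 z.2.1 ≤ N.storage zb z ∧
    sumPotential N.Tθ N.g zb.2.2.1 z.2.2.1 ≤ N.storage zb z ∧
    sumPotential N.Tφ (fun _ s => s) zb.2.2.2 z.2.2.2 ≤ N.storage zb z := by
  have h1 := sumPotential_nonneg (a := zb.1) N.Tx_pos (fun i => (N.h_contDiff i).continuous)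
    N.h_strictMono z.1
  have h2 := sumPotential_nonneg (a := zb.2.1) N.Tμ_pos
    (fun k => (hout.f_contDiff k).continuous) hout.f_strictMono z.2.1
  have h3 := sumPotential_nonneg (a := zb.2.2.1) N.Tθ_pos
    (fun i => (hout.g_contDiff i).continuous) hout.g_strictMono z.2.2.1
  have h4 := sumPotential_nonneg (a := zb.2.2.2) N.Tφ_pos (φ := fun _ s => s)
    (fun _ => continuous_id) (fun _ => strictMono_id) z.2.2.2
  have h : N.storage zb z = sumPotential N.Tx N.h zb.1 z.1 + sumPotential N.Tμ N.f zb.2.1 z.2.1 +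
    sumPotential N.Tθ N.g zb.2.2.1 z.2.2.1 +
    sumPotential N.Tφ (fun _ s => s) zb.2.2.2 z.2.2.2 := rfl
  refine ⟨?_, ?_, ?_, ?_⟩ <;> linarith

theorem storage_eq_zero_iff (hout : N.ControllerOutputs) (zb z : N.State) :
    N.storage zb z = 0 ↔ z = zb := by
  have i1 := sumPotential_eq_zero_iff (a := zb.1) N.Tx_pos
    (fun i => (N.h_contDiff i).continuous) N.h_strictMono
  have i2 := sumPotential_eq_zero_iff (a := zb.2.1) N.Tμ_pos
    (fun k => (hout.f_contDiff k).continuous) hout.f_strictMono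
  have i3 := sumPotential_eq_zero_iff (a := zb.2.2.1) N.Tθ_pos
    (fun i => (hout.g_contDiff i).continuous) hout.g_strictMono
  have i4 := sumPotential_eq_zero_iff (a := zb.2.2.2) N.Tφ_pos (φ := fun _ s => s)
    (fun _ => continuous_id) (fun _ => strictMono_id)
  constructor
  · intro h
    obtain ⟨h1, h2, h3, h4⟩ := storage_components_le hout zb z
    rw [h] at h1 h2 h3 h4
    refine Prod.ext ((i1 _).1 (h1.antisymm ?_)) (Prod.ext ((i2 _).1 (h2.antisymm ?_))
      (Prod.ext ((i3 _).1 (h3.antisymm ?_)) ((i4 _).1 (h4.antisymm ?_))))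
    · exact sumPotential_nonneg N.Tx_pos (fun i => (N.h_contDiff i).continuous) N.h_strictMono _
    · exact sumPotential_nonneg N.Tμ_pos (fun k => (hout.f_contDiff k).continuous)
        hout.f_strictMono _
    · exact sumPotential_nonneg N.Tθ_pos (fun i => (hout.g_contDiff i).continuous)
        hout.g_strictMono _
    · exact sumPotential_nonneg N.Tφ_pos (fun _ => continuous_id) (fun _ => strictMono_id) _
  · rintro rfl
    change _ + _ + _ + _ = (0 : ℝ)
    rw [(i1 _).2 rfl, (i2 _).2 rfl, (i3 _).2 rfl, (i4 _).2 rfl]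
    simp

theorem isCompact_storage_sublevel (hout : N.ControllerOutputs) (zb : N.State) (c : ℝ) :
    IsCompact {z | N.storage zb z ≤ c} := by
  obtain ⟨a₁, b₁, h₁⟩ := exists_forall_sumPotential_le (a := zb.1) N.Tx_pos
    (fun i => (N.h_contDiff i).continuous) N.h_strictMono c
  obtain ⟨a₂, b₂, h₂⟩ := exists_forall_sumPotential_le (a := zb.2.1) N.Tμ_pos
    (fun k => (hout.f_contDiff k).continuous) hout.f_strictMono c
  obtain ⟨a₃, b₃, h₃⟩ := exists_forall_sumPotential_le (a := zb.2.2.1) N.Tθ_pos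
    (fun i => (hout.g_contDiff i).continuous) hout.g_strictMono c
  obtain ⟨a₄, b₄, h₄⟩ := exists_forall_sumPotential_le (a := zb.2.2.2) N.Tφ_pos
    (φ := fun _ s => s) (fun _ => continuous_id) (fun _ => strictMono_id) c
  have hcont : Continuous (N.storage zb) :=
    continuous_iff_continuousAt.2 fun z => (hasFDerivAt_storage hout zb z).continuousAt
  have hK : IsCompact (Set.Icc a₁ b₁ ×ˢ Set.Icc a₂ b₂ ×ˢ Set.Icc a₃ b₃ ×ˢ Set.Icc a₄ b₄) :=
    isCompact_Icc.prod (isCompact_Icc.prod (isCompact_Icc.prod isCompact_Icc))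
  refine hK.of_isClosed_subset (isClosed_le hcont continuous_const) fun z hz => ?_
  obtain ⟨i1, i2, i3, i4⟩ := storage_components_le hout zb z
  have hz' : N.storage zb z ≤ c := hz
  exact ⟨h₁ _ (i1.trans hz'), h₂ _ (i2.trans hz'), h₃ _ (i3.trans hz'), h₄ _ (i4.trans hz')⟩

/-- The storage function dissipates along the closed loop. -/
theorem storageDeriv_closedLoop (hconn : N.graph.Connected) (hact : N.Ve.Nonempty)
    (hbal : N.CommBalanced) (hsc : N.CommStronglyConnected)
    {zb : N.State} (hzb : N.IsEquilibrium zb) (x : V → ℝ) (μ : K → ℝ) (θ φ : N.Ve → ℝ) :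
    N.storageDeriv zb (x, μ, θ, φ) (N.closedLoop (x, μ, θ, φ)) =
      -((N.input θ - φ) ⬝ᵥ (N.input θ - φ)) -
        (N.Q *ᵥ φ + N.r) ⬝ᵥ (N.Lcom *ᵥ (N.Q *ᵥ φ + N.r)) := by
  obtain ⟨xb, μb, θb, φb⟩ := zb
  obtain ⟨e1, e2, e3, rfl⟩ := (isEquilibrium_iff hconn hact hbal hsc _ _ _ _).1 hzb
  set ψ := N.Q *ᵥ φ + N.r with hψ
  have h0 : N.storageDeriv (xb, μb, θb, N.ubar) (x, μ, θ, φ) (N.closedLoop (x, μ, θ, φ)) =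
      (N.output x - N.output xb) ⬝ᵥ (-(N.B *ᵥ N.flow μ) + N.E *ᵥ N.input θ - N.d) +
      (N.flow μ - N.flow μb) ⬝ᵥ (N.Bᵀ *ᵥ (N.output x - N.ybar)) +
      (N.input θ - N.input θb) ⬝ᵥ (-(N.Eᵀ *ᵥ (N.output x - N.ybar)) - (N.input θ - φ)) +
      (φ - N.ubar) ⬝ᵥ (N.input θ - φ - N.Q *ᵥ (N.Lcom *ᵥ ψ)) :=
    congrArg₂ (· + ·) (congrArg₂ (· + ·) (congrArg₂ (· + ·)
      (sumPotentialDeriv_apply_inv_mul (φ := N.h) (a := xb) N.Tx_pos x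
        (-(N.B *ᵥ N.flow μ) + N.E *ᵥ N.input θ - N.d))
      (sumPotentialDeriv_apply_inv_mul (φ := N.f) (a := μb) N.Tμ_pos μ
        (N.Bᵀ *ᵥ (N.output x - N.ybar))))
      (sumPotentialDeriv_apply_inv_mul (φ := N.g) (a := θb) N.Tθ_pos θ
        (-(N.Eᵀ *ᵥ (N.output x - N.ybar)) - (N.input θ - φ))))
      (sumPotentialDeriv_apply_inv_mul (φ := fun _ s => s) (a := N.ubar) N.Tφ_pos φ
        (N.input θ - φ - N.Q *ᵥ (N.Lcom *ᵥ ψ)))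
  rw [e1, e3] at h0
  -- Subtracting the equilibrium balance removes `d` and leaves increments only.
  have h1 : -(N.B *ᵥ N.flow μ) + N.E *ᵥ N.input θ - N.d =
      -(N.B *ᵥ (N.flow μ - N.flow μb)) + N.E *ᵥ (N.input θ - N.ubar) := by
    rw [Matrix.mulVec_sub, Matrix.mulVec_sub, e2]
    abel
  -- `q_i (φ_i - ū_i)` equals `ψ_i` minus the common marginal cost, and the constant drops out
  -- because `L ψ` sums to zero.
  have h2 : (φ - N.ubar) ⬝ᵥ (N.Q *ᵥ (N.Lcom *ᵥ ψ)) = ψ ⬝ᵥ (N.Lcom *ᵥ ψ) := by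
    have hs := sum_Lcom_mulVec hbal ψ
    have : (φ - N.ubar) ⬝ᵥ (N.Q *ᵥ (N.Lcom *ᵥ ψ)) =
        ψ ⬝ᵥ (N.Lcom *ᵥ ψ) - N.marginalCost * ∑ i, (N.Lcom *ᵥ ψ) i := by
      simp only [dotProduct, Finset.mul_sum, ← Finset.sum_sub_distrib]
      refine Finset.sum_congr rfl fun i _ => ?_
      have := (N.q_pos i).ne'
      have hψi : ψ i = N.q i * φ i + N.r i := by rw [hψ, Pi.add_apply, Q_mulVec]
      rw [Q_mulVec, Pi.sub_apply, ubar_apply, hψi]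
      field_simp
      ring
    rw [this, hs, mul_zero, sub_zero]
  -- Once `B` and `E` are moved across the pairing, the interconnection terms occur in pairs of
  -- opposite sign.
  rw [h0, h1, dotProduct_add, dotProduct_neg, dotProduct_B_mulVec, dotProduct_E_mulVec,
    dotProduct_sub (φ - N.ubar), h2,
    dotProduct_sub (N.input θ - N.ubar) (-_), dotProduct_neg,
    dotProduct_comm (N.flow μ - N.flow μb), dotProduct_comm (N.input θ - N.ubar) (N.Eᵀ *ᵥ _)]
  have h3 : (N.input θ - φ) ⬝ᵥ (N.input θ - φ) =
      (N.input θ - N.ubar) ⬝ᵥ (N.input θ - φ) - (φ - N.ubar) ⬝ᵥ (N.input θ - φ) := by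
    rw [← sub_dotProduct, sub_sub_sub_cancel_right]
  rw [h3]
  ring

theorem isLyapunov_storage (hconn : N.graph.Connected) (hact : N.Ve.Nonempty)
    (hbal : N.CommBalanced) (hsc : N.CommStronglyConnected) (hout : N.ControllerOutputs)
    {zb : N.State} (hzb : N.IsEquilibrium zb) :
    IsLyapunov N.closedLoop (N.storage zb) (N.storageDeriv zb) where
  hasFDerivAt := hasFDerivAt_storage hout zb
  nonneg := storage_nonneg hout zb
  isCompact_sublevel := isCompact_storage_sublevel hout zb
  apply_nonpos := fun (x, μ, θ, φ) => by
    rw [storageDeriv_closedLoop hconn hact hbal hsc hzb]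
    have h1 := dotProduct_Lcom_mulVec_nonneg hbal (N.Q *ᵥ φ + N.r)
    have h2 : 0 ≤ (N.input θ - φ) ⬝ᵥ (N.input θ - φ) :=
      Finset.sum_nonneg fun i _ => mul_self_nonneg _
    linarith

theorem contDiff_closedLoop (hout : N.ControllerOutputs) : ContDiff ℝ 1 N.closedLoop := by
  have hh : ∀ i, ContDiff ℝ 1 fun z : N.State => N.h i (z.1 i) := fun i =>
    (N.h_contDiff i).comp (by fun_prop)
  have hf : ∀ k, ContDiff ℝ 1 fun z : N.State => N.f k (z.2.1 k) := fun k =>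
    (hout.f_contDiff k).comp (by fun_prop)
  have hg : ∀ i, ContDiff ℝ 1 fun z : N.State => N.g i (z.2.2.1 i) := fun i =>
    (hout.g_contDiff i).comp (by fun_prop)
  change ContDiff ℝ 1 fun z : N.State =>
    ((fun i => (N.Tx i)⁻¹ * (-(N.B *ᵥ N.flow z.2.1) + N.E *ᵥ N.input z.2.2.1 - N.d) i,
    fun k => (N.Tμ k)⁻¹ * (N.Bᵀ *ᵥ (N.output z.1 - N.ybar)) k,
    fun i => (N.Tθ i)⁻¹ * (-(N.Eᵀ *ᵥ (N.output z.1 - N.ybar)) - (N.input z.2.2.1 - z.2.2.2)) i,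
    fun i => (N.Tφ i)⁻¹ * (N.input z.2.2.1 - z.2.2.2 -
      N.Q *ᵥ (N.Lcom *ᵥ (N.Q *ᵥ z.2.2.2 + N.r))) i) : N.State)
  simp only [Matrix.mulVec, dotProduct, Pi.add_apply, Pi.sub_apply, Pi.neg_apply, flow, input,
    output]
  fun_prop

end FlowNetwork

/-! ### Solutions without dissipation and zero forcing -/

namespace FlowNetwork

variable {V K : Type*} [Fintype V] [DecidableEq V] [Fintype K] [DecidableEq K]
variable {N : FlowNetwork V K}

section components

variable {z : ℝ → N.State} {t : ℝ}

theorem IsSolution.hasDerivWithinAt_x (hz : N.IsSolution z) (ht : 0 ≤ t) (i : V) :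
    HasDerivWithinAt (fun t => (z t).1 i) ((N.closedLoop (z t)).1 i) (Set.Ici 0) t :=
  hasDerivWithinAt_pi.1 ((ContinuousLinearMap.fst ℝ (V → ℝ) _).hasFDerivAt.comp_hasDerivWithinAt
    t (hz t ht)) i

theorem IsSolution.hasDerivWithinAt_μ (hz : N.IsSolution z) (ht : 0 ≤ t) (k : K) :
    HasDerivWithinAt (fun t => (z t).2.1 k) ((N.closedLoop (z t)).2.1 k) (Set.Ici 0) t :=
  hasDerivWithinAt_pi.1 (((ContinuousLinearMap.fst ℝ (K → ℝ) _).comp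
    (.snd ℝ (V → ℝ) _)).hasFDerivAt.comp_hasDerivWithinAt t (hz t ht)) k

theorem IsSolution.hasDerivWithinAt_θ (hz : N.IsSolution z) (ht : 0 ≤ t) (i : N.Ve) :
    HasDerivWithinAt (fun t => (z t).2.2.1 i) ((N.closedLoop (z t)).2.2.1 i) (Set.Ici 0) t :=
  hasDerivWithinAt_pi.1 (((ContinuousLinearMap.fst ℝ (N.Ve → ℝ) _).comp
    ((ContinuousLinearMap.snd ℝ (K → ℝ) _).comp
      (.snd ℝ (V → ℝ) _))).hasFDerivAt.comp_hasDerivWithinAt t (hz t ht)) i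

theorem IsSolution.hasDerivWithinAt_φ (hz : N.IsSolution z) (ht : 0 ≤ t) (i : N.Ve) :
    HasDerivWithinAt (fun t => (z t).2.2.2 i) ((N.closedLoop (z t)).2.2.2 i) (Set.Ici 0) t :=
  hasDerivWithinAt_pi.1 (((ContinuousLinearMap.snd ℝ (N.Ve → ℝ) _).comp
    ((ContinuousLinearMap.snd ℝ (K → ℝ) _).comp
      (.snd ℝ (V → ℝ) _))).hasFDerivAt.comp_hasDerivWithinAt t (hz t ht)) i

theorem closedLoop_x (z : N.State) (i : V) : (N.closedLoop z).1 i =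
    (N.Tx i)⁻¹ * (-(N.B *ᵥ N.flow z.2.1) i + (N.E *ᵥ N.input z.2.2.1) i - N.d i) := rfl

theorem closedLoop_μ (z : N.State) (k : K) : (N.closedLoop z).2.1 k =
    (N.Tμ k)⁻¹ * (N.Bᵀ *ᵥ (N.output z.1 - N.ybar)) k := rfl

theorem closedLoop_θ (z : N.State) (i : N.Ve) : (N.closedLoop z).2.2.1 i =
    (N.Tθ i)⁻¹ * (-(N.Eᵀ *ᵥ (N.output z.1 - N.ybar)) i - (N.input z.2.2.1 i - z.2.2.2 i)) := rfl

theorem closedLoop_φ (z : N.State) (i : N.Ve) : (N.closedLoop z).2.2.2 i =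
    (N.Tφ i)⁻¹ * (N.input z.2.2.1 i - z.2.2.2 i -
      (N.Q *ᵥ (N.Lcom *ᵥ (N.Q *ᵥ z.2.2.2 + N.r))) i) := rfl

end components

/-- Transfers a signed change of the edge state to the same signed change of the flow, whichever end
of the edge is seen. -/
theorem mul_lt_mul_of_incidence {b T m m' : ℝ} {f : ℝ → ℝ} (hb : b = 0 ∨ b = 1 ∨ b = -1)
    (hT : 0 < T) (hf : StrictMono f) (h : b * (T * m) < b * (T * m')) : b * f m < b * f m' := by
  rcases hb with rfl | rfl | rfl
  · simp at h
  · simpa using hf (lt_of_mul_lt_mul_left (by simpa using h) hT.le)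
  · simpa using hf (lt_of_mul_lt_mul_left (by simpa using h) hT.le)

theorem mul_le_mul_of_incidence {b T m m' : ℝ} {f : ℝ → ℝ} (hb : b = 0 ∨ b = 1 ∨ b = -1)
    (hT : 0 < T) (hf : StrictMono f) (h : b * (T * m) ≤ b * (T * m')) : b * f m ≤ b * f m' := by
  rcases h.lt_or_eq with h | h
  · exact (mul_lt_mul_of_incidence hb hT hf h).le
  · rcases hb with rfl | rfl | rfl
    · simp
    all_goals
      have : m = m' := mul_left_cancel₀ hT.ne' (by linarith)
      rw [this]

theorem B_apply_mem (i : V) (k : K) : N.B i k = 0 ∨ N.B i k = 1 ∨ N.B i k = -1 := by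
  simp only [B, Matrix.of_apply]
  split_ifs <;> simp

/-- If the balance of the flows at a node is at rest and its output is regulated, then so is the
output of its only neighbour outside a set of nodes with regulated outputs. -/
theorem output_eq_of_forcing {z : ℝ → N.State} (hz : N.IsSolution z) (hout : N.ControllerOutputs)
    {S : Set V} (hS : ∀ i ∈ S, ∀ t, 0 ≤ t → N.output (z t).1 i = N.ybar i)
    {i j : V} (hi : i ∈ S) (hij : N.graph.Adj i j)
    (huniq : ∀ k, N.graph.Adj i k → k ∉ S → k = j)
    (hflow : ∀ t, 0 ≤ t → (N.B *ᵥ N.flow (z t).2.1) i = (N.B *ᵥ N.flow (z 0).2.1) i)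
    {t : ℝ} (ht : 0 ≤ t) : N.output (z t).1 j = N.ybar j := by
  -- The sign `B i k` and the weight `Tμ k` make the derivative independent of orientation and time
  -- constant: with `i` regulated, it is minus the output error at the other end of the edge.
  set D : K → ℝ → ℝ := fun k t => N.B i k * (N.Tμ k * (z t).2.1 k) with hD
  set δ : ℝ → ℝ := fun t => N.output (z t).1 j - N.ybar j with hδ
  have hderiv : ∀ k t, 0 ≤ t → HasDerivWithinAt (D k)
      (N.B i k * (N.Bᵀ *ᵥ (N.output (z t).1 - N.ybar)) k) (Set.Ici 0) t := by
    intro k t ht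
    have h1 := ((hz.hasDerivWithinAt_μ ht k).const_mul (N.Tμ k)).const_mul (N.B i k)
    rwa [closedLoop_μ, mul_inv_cancel_left₀ (N.Tμ_pos k).ne'] at h1
  -- the derivative of `D k` is determined by the other end of the edge `k`
  have hdichotomy : ∀ k, (∀ t, 0 ≤ t → HasDerivWithinAt (D k) 0 (Set.Ici 0) t) ∨
      (∀ t, 0 ≤ t → HasDerivWithinAt (D k) (-δ t) (Set.Ici 0) t) := by
    intro k
    have hother : ∀ l, N.graph.Adj i l →
        (∀ t, 0 ≤ t → N.B i k * (N.Bᵀ *ᵥ (N.output (z t).1 - N.ybar)) k =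
          -(N.output (z t).1 l - N.ybar l)) →
        (∀ t, 0 ≤ t → HasDerivWithinAt (D k) 0 (Set.Ici 0) t) ∨
          (∀ t, 0 ≤ t → HasDerivWithinAt (D k) (-δ t) (Set.Ici 0) t) := by
      intro l hl h
      by_cases hlS : l ∈ S
      · refine .inl fun t ht => ?_
        have := hderiv k t ht
        rwa [h t ht, hS l hlS t ht, sub_self, neg_zero] at this
      · obtain rfl := huniq l hl hlS
        refine .inr fun t ht => ?_
        have := hderiv k t ht
        rwa [h t ht] at this
    by_cases hpos : i = N.pos k
    · refine hother (N.neg k) ⟨k, .inl ⟨hpos.symm, rfl⟩⟩ fun t ht => ?_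
      rw [B_transpose_mulVec, Pi.sub_apply, ← hpos, hS i hi t ht]
      simp [B, hpos]
    · by_cases hneg : i = N.neg k
      · refine hother (N.pos k) ⟨k, .inr ⟨rfl, hneg.symm⟩⟩ fun t ht => ?_
        rw [B_transpose_mulVec, Pi.sub_apply, Pi.sub_apply, ← hneg, hS i hi t ht]
        simp [B, hneg, (N.pos_ne_neg k).symm]
      · refine .inl fun t ht => ?_
        have := hderiv k t ht
        rwa [show N.B i k = 0 by simp [B, hpos, hneg], zero_mul] at this
  obtain ⟨k₀, hk₀⟩ := hij
  have hk₀deriv : ∀ t, 0 ≤ t → HasDerivWithinAt (D k₀) (-δ t) (Set.Ici 0) t := by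
    intro t ht
    have h := hderiv k₀ t ht
    convert h using 1
    rcases hk₀ with ⟨h1, h2⟩ | ⟨h1, h2⟩
    · rw [B_transpose_mulVec, Pi.sub_apply, h1, h2, hS i hi t ht]
      simp [B, h1, hδ]
    · rw [B_transpose_mulVec, Pi.sub_apply, Pi.sub_apply, h1, h2, hS i hi t ht]
      have := N.pos_ne_neg k₀
      rw [h1, h2] at this
      simp [B, h1, h2, this.symm, hδ]
  -- Parallel edges from `i` to `j` are driven by the same `-δ`, so their `D` changes exactly as
  -- that of `k₀`; every other `D k` is constant.
  have hlevel : ∀ k s t, 0 ≤ s → 0 ≤ t → D k t = D k s ∨ D k t - D k s = D k₀ t - D k₀ s := by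
    intro k s t hs ht
    rcases hdichotomy k with h | h
    · left
      rw [eq_of_hasDerivWithinAt_Ici_zero h ht, eq_of_hasDerivWithinAt_Ici_zero h hs]
    · right
      have h0 : ∀ t, 0 ≤ t → HasDerivWithinAt (fun t => D k t - D k₀ t) 0 (Set.Ici 0) t := by
        intro t ht
        have := (h t ht).sub (hk₀deriv t ht)
        rwa [sub_self] at this
      linarith [eq_of_hasDerivWithinAt_Ici_zero h0 ht, eq_of_hasDerivWithinAt_Ici_zero h0 hs]
  -- An increase of `D k₀` would lower no signed flow at `i` and strictly raise that of `k₀`,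
  -- against the constant net flow. No order between `s` and `t` is assumed, so decreases are
  -- excluded too.
  have hnlt : ∀ s t, 0 ≤ s → 0 ≤ t → ¬ D k₀ s < D k₀ t := by
    intro s t hs ht hlt
    have hsum : (N.B *ᵥ N.flow (z s).2.1) i < (N.B *ᵥ N.flow (z t).2.1) i := by
      refine Finset.sum_lt_sum (fun k _ => ?_) ⟨k₀, Finset.mem_univ _, ?_⟩
      · refine mul_le_mul_of_incidence (B_apply_mem i k) (N.Tμ_pos k) (hout.f_strictMono k) ?_
        change D k s ≤ D k t
        rcases hlevel k s t hs ht with h | h <;> linarith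
      · exact mul_lt_mul_of_incidence (B_apply_mem i k₀) (N.Tμ_pos k₀) (hout.f_strictMono k₀) hlt
    rw [hflow s hs, hflow t ht] at hsum
    exact lt_irrefl _ hsum
  have hconst : ∀ s, 0 ≤ s → D k₀ s = D k₀ 0 := fun s hs =>
    le_antisymm (not_lt.1 (hnlt 0 s le_rfl hs)) (not_lt.1 (hnlt s 0 hs le_rfl))
  have hδ0 := (hk₀deriv t ht).eq_zero_of_const_Ici ht hconst
  exact sub_eq_zero.1 (neg_eq_zero.1 hδ0)

/-- A state from which a solution without dissipation starts is an equilibrium. -/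
theorem isEquilibrium_of_no_dissipation (hbal : N.CommBalanced)
    (hsc : N.CommStronglyConnected) (hout : N.ControllerOutputs)
    (hzf : IsZeroForcingSet N.graph (N.Ve : Set V)) {z : ℝ → N.State} (hz : N.IsSolution z)
    (hdiss : ∀ t, 0 ≤ t → N.input (z t).2.2.1 = (z t).2.2.2 ∧
      (N.Q *ᵥ (z t).2.2.2 + N.r) ⬝ᵥ (N.Lcom *ᵥ (N.Q *ᵥ (z t).2.2.2 + N.r)) = 0) :
    N.IsEquilibrium (z 0) := by
  have hL : ∀ t, 0 ≤ t → N.Q *ᵥ (N.Lcom *ᵥ (N.Q *ᵥ (z t).2.2.2 + N.r)) = 0 := by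
    intro t ht
    have h := eq_of_dotProduct_Lcom_mulVec_eq_zero hbal hsc (hdiss t ht).2
    have h0 : N.Lcom *ᵥ (N.Q *ᵥ (z t).2.2.2 + N.r) = 0 := by
      funext i
      exact congrFun (N.Lcom_mulVec_const fun j => h j i) i
    rw [h0, Matrix.mulVec_zero]
  have hφ : ∀ t, 0 ≤ t → (z t).2.2.2 = (z 0).2.2.2 := by
    intro t ht
    funext i
    refine eq_of_hasDerivWithinAt_Ici_zero (γ := fun t => (z t).2.2.2 i) (fun s hs => ?_) ht
    have h := hz.hasDerivWithinAt_φ hs i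
    rwa [closedLoop_φ, hL s hs, (hdiss s hs).1, sub_self, Pi.zero_apply, sub_zero, mul_zero] at h
  have hinput : ∀ t, 0 ≤ t → N.input (z t).2.2.1 = N.input (z 0).2.2.1 := fun t ht => by
    rw [(hdiss t ht).1, (hdiss 0 le_rfl).1, hφ t ht]
  -- A regulated output freezes `x_i`, so the node equation becomes a balance with the constant
  -- input.
  have hrest : ∀ (i : V), (∀ t, 0 ≤ t → N.output (z t).1 i = N.ybar i) →
      ∀ t, 0 ≤ t → (N.B *ᵥ N.flow (z t).2.1) i = (N.E *ᵥ N.input (z 0).2.2.1) i - N.d i := by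
    intro i hi t ht
    have hx : ∀ s, 0 ≤ s → (z s).1 i = (z 0).1 i := fun s hs =>
      (N.h_strictMono i).injective ((hi s hs).trans (hi 0 le_rfl).symm)
    have h := (hz.hasDerivWithinAt_x ht i).eq_zero_of_const_Ici ht hx
    rw [closedLoop_x, mul_eq_zero, or_iff_right (inv_pos.2 (N.Tx_pos i)).ne', hinput t ht] at h
    linarith
  -- Constant inputs freeze `θ`; with `g(θ) = φ`, the `θ` equation then leaves only the output
  -- error.
  have hVe : ∀ i ∈ (N.Ve : Set V), ∀ t, 0 ≤ t → N.output (z t).1 i = N.ybar i := by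
    intro i hi t ht
    have hθ : ∀ s, 0 ≤ s → (z s).2.2.1 ⟨i, hi⟩ = (z 0).2.2.1 ⟨i, hi⟩ := fun s hs =>
      (hout.g_strictMono ⟨i, hi⟩).injective (congrFun (hinput s hs) ⟨i, hi⟩)
    have h := (hz.hasDerivWithinAt_θ ht ⟨i, hi⟩).eq_zero_of_const_Ici ht hθ
    rw [closedLoop_θ, mul_eq_zero, or_iff_right (inv_pos.2 (N.Tθ_pos _)).ne', (hdiss t ht).1,
      sub_self, sub_zero, neg_eq_zero, E_transpose_mulVec] at h
    exact sub_eq_zero.1 h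
  have hall : ∀ S, Relation.ReflTransGen (ForcingStep N.graph) (N.Ve : Set V) S →
      ∀ i ∈ S, ∀ t, 0 ≤ t → N.output (z t).1 i = N.ybar i := by
    intro S hS
    induction hS with
    | refl => exact hVe
    | tail _ hstep ih =>
      obtain ⟨i, j, hi, -, hij, huniq⟩ := hstep
      intro k hk t ht
      rcases hk with rfl | hk
      · exact output_eq_of_forcing hz hout ih hi hij huniq (fun s hs => by
          rw [hrest i (ih i hi) s hs, hrest i (ih i hi) 0 le_rfl]) ht
      · exact ih k hk t ht
  have hout0 : ∀ i, ∀ t, 0 ≤ t → N.output (z t).1 i = N.ybar i :=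
    fun i => hall _ hzf i (Set.mem_univ i)
  have hy : N.output (z 0).1 - N.ybar = 0 :=
    sub_eq_zero.2 (funext fun i => hout0 i 0 le_rfl)
  refine (isEquilibrium_iff_balance _ _ _ _).2 ⟨?_, ?_, ?_, ?_⟩
  · funext i
    have := hrest i (hout0 i) 0 le_rfl
    simp only [Pi.sub_apply, Pi.add_apply, Pi.neg_apply, Pi.zero_apply]
    linarith
  · rw [hy, Matrix.mulVec_zero]
  · rw [hy, Matrix.mulVec_zero, (hdiss 0 le_rfl).1]
    simp
  · rw [hL 0 le_rfl, (hdiss 0 le_rfl).1]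
    simp

/-! ### Convergence and the control objectives -/

/-- Every solution converges to an equilibrium. -/
theorem IsSolution.exists_tendsto_isEquilibrium (hconn : N.graph.Connected)
    (hact : N.Ve.Nonempty) (hbal : N.CommBalanced) (hsc : N.CommStronglyConnected)
    (hout : N.ControllerOutputs) (hzf : IsZeroForcingSet N.graph (N.Ve : Set V))
    {zb : N.State} (hzb : N.IsEquilibrium zb) {z : ℝ → N.State} (hz : N.IsSolution z) :
    ∃ p, N.IsEquilibrium p ∧ Tendsto z atTop (𝓝 p) := by
  obtain ⟨w, hw, hcl, hstat⟩ := (isLyapunov_storage hconn hact hbal hsc hout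
    hzb).exists_stationary_solution (contDiff_closedLoop hout) hz
  have hp : N.IsEquilibrium (w 0) := by
    refine isEquilibrium_of_no_dissipation hbal hsc hout hzf hw fun t ht => ?_
    have h := hstat t ht
    rw [show w t = ((w t).1, (w t).2.1, (w t).2.2.1, (w t).2.2.2) from rfl,
      storageDeriv_closedLoop hconn hact hbal hsc hzb] at h
    have h1 := dotProduct_Lcom_mulVec_nonneg hbal (N.Q *ᵥ (w t).2.2.2 + N.r)
    have h2 : 0 ≤ (N.input (w t).2.2.1 - (w t).2.2.2) ⬝ᵥ (N.input (w t).2.2.1 - (w t).2.2.2) :=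
      Finset.sum_nonneg fun i _ => mul_self_nonneg _
    exact ⟨sub_eq_zero.1 (dotProduct_self_eq_zero.1 (by linarith)), by linarith⟩
  -- The storage is centred anew at the limit point `w 0`, which is thereby its only zero.
  exact ⟨w 0, hp, (isLyapunov_storage hconn hact hbal hsc hout hp).tendsto_of_mapClusterPt hz
    (storage_eq_zero_iff hout (w 0)) hcl⟩

theorem continuous_pi_apply {ι : Type*} {F : ι → ℝ → ℝ} (hF : ∀ i, Continuous (F i)) :
    Continuous fun (x : ι → ℝ) i => F i (x i) :=
  continuous_pi fun i => (hF i).comp (continuous_apply i)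

theorem meetsObjectives_of_tendsto (hout : N.ControllerOutputs) {z : ℝ → N.State} {p : N.State}
    (hz : Tendsto z atTop (𝓝 p)) (hy : N.output p.1 = N.ybar)
    (hu : N.input p.2.2.1 = N.ubar) : N.MeetsObjectives z where
  output_regulation := by
    have hc : Continuous fun z : N.State => ‖WithLp.toLp 2 (N.output z.1 - N.ybar)‖ :=
      ((PiLp.continuous_toLp 2 _).comp (((continuous_pi_apply fun i =>
        (N.h_contDiff i).continuous).comp continuous_fst).sub continuous_const)).norm
    have := (hc.tendsto p).comp hz
    rwa [hy, sub_self, WithLp.toLp_zero, norm_zero] at this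
  optimal_input := by
    have hc : Continuous fun z : N.State => ‖WithLp.toLp 2 (N.input z.2.2.1 - N.ubar)‖ :=
      ((PiLp.continuous_toLp 2 _).comp (((continuous_pi_apply fun i =>
        (hout.g_contDiff i).continuous).comp (by fun_prop :
          Continuous fun z : N.State => z.2.2.1)).sub continuous_const)).norm
    have := (hc.tendsto p).comp hz
    rwa [hu, sub_self, WithLp.toLp_zero, norm_zero] at this
  flow_capacity t _ k := by
    have : N.flow (z t).2.1 k ∈ Set.range (N.f k) := ⟨_, rfl⟩
    rwa [hout.f_range] at this
  input_limitation t _ i := by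
    have : N.input (z t).2.2.1 i ∈ Set.range (N.g i) := ⟨_, rfl⟩
    rwa [hout.g_range] at this

end FlowNetwork

end

theorem theorem3 {V K : Type*} [Fintype V] [DecidableEq V] [Fintype K] [DecidableEq K]
    (N : FlowNetwork V K)
    (hconn : N.graph.Connected)
    (hact : N.Ve.Nonempty)
    (hset : N.FeasibleSetpoint)
    (hbal : N.CommBalanced)
    (hsc : N.CommStronglyConnected)
    (hatt : N.Attainable)
    (hout : N.ControllerOutputs)
    (hzf : IsZeroForcingSet N.graph (N.Ve : Set V)) :
    -- a steady state exists, and solutions exist on `[0, ∞)` for all initial states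
    (∃ zb, N.IsEquilibrium zb) ∧
    (∀ z₀ : N.State, ∃ z, N.IsSolution z ∧ z 0 = z₀) ∧
    -- for every steady state and the associated set `Υ₃`
    ∀ zb, N.IsEquilibrium zb →
      -- on `Υ₃` the whole state (hence `λ = f(μ)`) is at rest, `h(x) = ȳ` and `g(θ) = ū`
      (∀ p ∈ N.Upsilon zb, N.IsEquilibrium p ∧ N.output p.1 = N.ybar ∧ N.input p.2.2.1 = N.ubar) ∧
      -- every solution converges to a point of `Υ₃` and meets objectives and constraints
      ∀ z, N.IsSolution z →
        (∃ p ∈ N.Upsilon zb, Tendsto z atTop (𝓝 p) ∧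
          Tendsto (fun t => N.flow (z t).2.1) atTop (𝓝 (N.flow p.2.1))) ∧
        N.MeetsObjectives z := by
  obtain ⟨zb₀, hzb₀⟩ := FlowNetwork.exists_isEquilibrium hconn hact hset hbal hsc hatt
  refine ⟨⟨zb₀, hzb₀⟩, fun z₀ => (FlowNetwork.isLyapunov_storage hconn hact hbal hsc hout
    hzb₀).exists_isForwardSolution (FlowNetwork.contDiff_closedLoop hout) z₀, fun zb hzb => ?_⟩
  have hrest : ∀ p ∈ N.Upsilon zb,
      N.IsEquilibrium p ∧ N.output p.1 = N.ybar ∧ N.input p.2.2.1 = N.ubar := fun p hp =>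
    FlowNetwork.isEquilibrium_of_mem_upsilon hconn hact hbal hsc hzb hp
  refine ⟨hrest, fun z hz => ?_⟩
  obtain ⟨p, hp, hlim⟩ := hz.exists_tendsto_isEquilibrium hconn hact hbal hsc hout hzf hzb
  have hpU := FlowNetwork.mem_upsilon_of_isEquilibrium hconn hact hbal hsc hout hzb hp
  obtain ⟨-, hy, hu⟩ := hrest p hpU
  have hcont : Continuous fun z : N.State => N.flow z.2.1 :=
    (FlowNetwork.continuous_pi_apply fun k => (hout.f_contDiff k).continuous).comp
      (continuous_fst.comp continuous_snd)
  exact ⟨⟨p, hpU, hlim, (hcont.tendsto p).comp hlim⟩,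
    FlowNetwork.meetsObjectives_of_tendsto hout hlim hy hu⟩
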